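/- Let $W:[0,1]^2\to[0,1]$ be a graphon (a symmetric measurable function). Let $X=(X_i)_{i\ge 1}$ be i.i.d. uniform random variables on $[0,1]$ and let $(G_n)_{n\ge 1}$ be the associated $W$-random graphs: $G_n$ is a random simple graph with vertex set $[n]=\{1,\dots,n\}$ such that, given $X$, the pairs $\{i,j\}$, $1\le i<j\le n$, are edges of $G_n$ independently, with probabilities $W(X_i,X_j)$. Let $\mathcal F$ be the (countable) set of simple finite graphs $F$, with vertex set $V(F)$ identified with $[v(F)]$ and edge set $E(F)$. For $F\in\mathcal F$, a vertex $q\in V(F)$ and $u\in[0,1]$ put $$t(F,W)=\int_{[0,1]^{V(F)}}\prod_{\{i,j\}\in E(F)}W(x_i,x_j)\prod_{k\in V(F)}dx_k ,$$ $$t_u(F^q,W)=\int_{[0,1]^{V(F)\setminus\{q\}}}\prod_{\{i,j\}\in E(F)}W(x_i,x_j)\Big|_{x_q=u}\prod_{k\in V(F)\setminus\{q\}}dx_k ,$$ and, for a graph $G$ with $n\ge v(F)$ vertices, $t_{\rm inj}(F,G)=|{\rm Inj}(F,G)|\,\frac{(n-v(F))!}{n!}$, where ${\rm Inj}(F,G)$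 is the set of injective maps $V(F)\to V(G)$ that preserve adjacency. For $F,F'\in\mathcal F$, $q\in V(F)$, $q'\in V(F')$, let $(F\bowtie F')(q,q')$ be the disjoint union of $F$ and $F'$ in which the vertices $q$ and $q'$ are identified, and define $$K_{\rm inj}(F,F')=\sum_{q\in V(F)}\sum_{q'\in V(F')}t\big((F\bowtie F')(q,q'),W\big)-v(F)\,v(F')\,t(F,W)\,t(F',W).$$ Corollary 3.3. (1) For all $F,F'\in\mathcal F$, with $U$ uniform on $[0,1]$, $$K_{\rm inj}(F,F')={\rm Cov}\Big(\sum_{q\in V(F)}t_U(F^q,W),\ \sum_{q'\in V(F')}t_U(F'^{q'},W)\Big).$$ (2) There is a centered Gaussian process $\Theta_{\rm inj}=(\Theta_{\rm inj}(F):F\in\mathcal F)$ with covariance function $K_{\rm inj}$, and the process $\big(\sqrt n\,(t_{\rm inj}(F,G_n)-t(F,W)):F\in\mathcal F\big)$ converges to $\Theta_{\rm inj}$ as $n\to\infty$ in the sense of finite-dimensional distributions. (3) In particular, for every $F\in\mathcal F$, $\sqrt n\,(t_{\rm inj}(F,G_n)-t(F,W))$ converges in distribution to $\mathcal N(0,\sigma(F)^2)$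 with $\sigma(F)^2=K_{\rm inj}(F,F)$ (the central limit theorem of Féray, Méliot and Nikeghbali). (4) In particular, for every quantum graph $\mathfrak F=\sum_{m=1}^d a_mF_m$ (a formal linear combination of graphs $F_m\in\mathcal F$ with coefficients $a_m\in\mathbb R$), with $t_{\rm inj}(\mathfrak F,G)=\sum_m a_m t_{\rm inj}(F_m,G)$ and $t(\mathfrak F,W)=\sum_m a_m t(F_m,W)$, the sequence $\sqrt n\,(t_{\rm inj}(\mathfrak F,G_n)-t(\mathfrak F,W))$ converges in distribution to $\mathcal N(0,\sigma(\mathfrak F)^2)$, where $$\sigma(\mathfrak F)^2=\sum_{m,m'=1}^d a_ma_{m'}K_{\rm inj}(F_m,F_{m'})={\rm Var}\Big(\sum_{m=1}^d a_m\sum_{q\in V(F_m)}t_U(F_m^q,W)\Big).$$ Here $\mathcal N(0,0)$ is the Dirac mass at $0$, and Gaussian vectors may be degenerate. -/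

import Mathlib

open MeasureTheory ProbabilityTheory Filter
open scoped unitInterval NNReal SimpleGraph

/-- A graphon: a symmetric (Borel) measurable function `[0,1]² → [0,1]`. -/
structure Graphon where
  toFun : I → I → I
  symm : ∀ x y, toFun x y = toFun y x
  measurable : Measurable (Function.uncurry toFun)

/-- A simple finite graph, its vertex set being identified with `{0, …, v - 1}`. -/
structure FinGraph where
  /-- the number of vertices -/
  v : ℕ
  graph : SimpleGraph (Fin v)

noncomputable section

namespace Graphon

/-- The value `W(x_i, x_j)` attached to an unordered pair `{i, j}`. -/
def edgeWeight (W : Graphon) {V : Type*} (x : V → I) (e : Sym2 V) : ℝ :=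
  Sym2.lift ⟨fun i j => (W.toFun (x i) (x j) : ℝ), fun i j => by simp only [W.symm (x i) (x j)]⟩ e

open scoped Classical in
/-- `Z(x) = ∏_{{i,j} ∈ E(F)} W(x_i, x_j)`. -/
def edgeProd (W : Graphon) {V : Type*} [Finite V] (F : SimpleGraph V) (x : V → I) : ℝ :=
  letI := Fintype.ofFinite V
  ∏ e ∈ F.edgeFinset, W.edgeWeight x e

/-- Homomorphism density `t(F, W) = ∫_{[0,1]^{V(F)}} ∏_{{i,j} ∈ E(F)} W(x_i, x_j) dx`. -/
def homDensity {V : Type*} [Finite V] (F : SimpleGraph V) (W : Graphon) : ℝ :=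
  letI := Fintype.ofFinite V
  ∫ x : V → I, W.edgeProd F x

open scoped Classical in
/-- Homomorphism density `t_u(F^q, W)` of the graph `F` with a single labelled vertex `q`: the
variable of `q` is set to `u`, the other variables are integrated over `[0,1]`. (The integrand does
not depend on the coordinate `x q`, which is integrated against a probability measure.) -/
def labelledHomDensity {V : Type*} [Finite V] (F : SimpleGraph V) (q : V) (W : Graphon)
    (u : I) : ℝ :=
  letI := Fintype.ofFinite V
  ∫ x : V → I, W.edgeProd F (Function.update x q u)

end Graphon

/-- Injective homomorphism density `t_inj(F, G) = |Inj(F, G)| / A_{v(G)}^{v(F)}`, where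
`A_n^p = n! / (n - p)!`. (`SimpleGraph.Copy F G` is the type of injective homomorphisms from `F`
to `G`. The value is `0` by convention if `v(G) < v(F)`.) -/
def injDensity {V V' : Type*} (F : SimpleGraph V) (G : SimpleGraph V') : ℝ :=
  (Nat.card (SimpleGraph.Copy F G) : ℝ) / ((Nat.card V').descFactorial (Nat.card V) : ℝ)

/-- The relation on `V ⊔ V'` which identifies `q ∈ V` with `q' ∈ V'` (and nothing else). -/
inductive GlueRel {V V' : Type*} (q : V) (q' : V') : V ⊕ V' → V ⊕ V' → Prop
  | glue : GlueRel q q' (Sum.inl q) (Sum.inr q')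

/-- The vertex set `(V ⊔ V') / {q ∼ q'}`. -/
abbrev GlueVertex {V V' : Type*} (q : V) (q' : V') : Type _ := Quot (GlueRel q q')

/-- The graph `(F ⋈ F')(q, q') = (F ⊔ F') / {q ∼ q'}`: disjoint union of `F` and `F'`, with the
vertices `q` of `F` and `q'` of `F'` identified. -/
def SimpleGraph.glue {V V' : Type*} (F : SimpleGraph V) (F' : SimpleGraph V') (q : V) (q' : V') :
    SimpleGraph (GlueVertex q q') :=
  (F ⊕g F').map (Quot.mk (GlueRel q q'))

/-- `X` and `G` are a sequence of i.i.d. uniform random variables on `[0,1]` and an associated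
sequence of `W`-random graphs, `G n` having vertex set `{0, …, n - 1}`: given the sequence `X`, the
pairs `{i, j}`, `i < j`, are edges of `G n` independently, with probabilities `W(X_i, X_j)`; that is,
given `X`, the probability that all pairs of a set `S` are edges is the product of the `W(X_i, X_j)`
over `S`. Nothing is required of the dependence between different values of `n`. -/
structure IsWRandomGraphs {Ω : Type*} [MeasurableSpace Ω] (P : Measure Ω) (W : Graphon)
    (X : ℕ → Ω → I) (G : (n : ℕ) → Ω → SimpleGraph (Fin n)) : Prop where
  measurable_X : ∀ i, Measurable (X i)
  uniform_X : ∀ i, P.map (X i) = volume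
  indep_X : iIndepFun X P
  measurable_adj : ∀ n i j, MeasurableSet {ω | (G n ω).Adj i j}
  condProb_adj : ∀ (n : ℕ) (S : Finset (Fin n × Fin n)), (∀ e ∈ S, e.1 < e.2) →
    P⟦{ω | ∀ e ∈ S, (G n ω).Adj e.1 e.2} |
        MeasurableSpace.comap (fun ω i => X i ω) MeasurableSpace.pi⟧
      =ᵐ[P] fun ω => ∏ e ∈ S, (W.toFun (X e.1 ω) (X e.2 ω) : ℝ)

namespace FinGraph

/-- `t(F, W)`. -/
def t (F : FinGraph) (W : Graphon) : ℝ := W.homDensity F.graph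

/-- `t_inj(F, G)`. -/
def tInj (F : FinGraph) {n : ℕ} (G : SimpleGraph (Fin n)) : ℝ := injDensity F.graph G

/-- `∑_{q ∈ V(F)} t_u(F^q, W)`. -/
def labelledSum (F : FinGraph) (W : Graphon) (u : I) : ℝ :=
  ∑ q : Fin F.v, W.labelledHomDensity F.graph q u

/-- The covariance function
`K_inj(F, F') = ∑_{q, q'} t((F ⋈ F')(q, q'), W) - v(F) v(F') t(F, W) t(F', W)`. -/
def kInj (W : Graphon) (F F' : FinGraph) : ℝ :=
  (∑ q : Fin F.v, ∑ q' : Fin F'.v, W.homDensity (F.graph.glue F'.graph q q'))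
    - (F.v : ℝ) * (F'.v : ℝ) * F.t W * F'.t W

end FinGraph

/-- A (simple) quantum graph: a formal finite linear combination of simple finite graphs with real
coefficients. -/
abbrev QuantumGraph : Type := FinGraph →₀ ℝ

namespace QuantumGraph

/-- `t(∑ a_m F_m, W) = ∑ a_m t(F_m, W)`. -/
def t (A : QuantumGraph) (W : Graphon) : ℝ := A.sum fun F a => a * F.t W

/-- `t_inj(∑ a_m F_m, G) = ∑ a_m t_inj(F_m, G)`. -/
def tInj (A : QuantumGraph) {n : ℕ} (G : SimpleGraph (Fin n)) : ℝ := A.sum fun F a => a * F.tInj G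

end QuantumGraph

end

/-! The fluctuations of order n^(-1/2) come from the vertex variables X_i alone, through a sum of
i.i.d. terms. The injective density is an average, over embeddings φ of V(F) into [n], of the
indicator that φ(F) lies in G_n. Replacing each indicator by `projection`, that is t + Σ_q
(t_{X_φ(q)}(F^q) - t), turns this average into t + n⁻¹ Σ_i (S(X_i) - v t), where S is `labelledSum`:
this is the Hájek projection.

The errors made for two embeddings are orthogonal in L² unless these share at least two vertices
(`integral_residual_mul_eq_zero`): with at most one common vertex there is no common edge, so given
the shared variable the errors are independent, each with conditional mean zero. Only a proportion
O(n⁻²) of the pairs of embeddings share two vertices (`card_embedding_pairs_le`), so the remainder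
has second moment O(n⁻²) (`integral_remainder_sq_le`) and vanishes after multiplication by √n. The
classical central limit theorem and Slutsky's lemma then settle all linear combinations, and the
Cramér–Wold device gives the finite-dimensional distributions.

For the covariance, gluing two graphs at a vertex multiplies their labelled densities under the
integral (`homDensity_glue`). Hence K_inj is the covariance of the labelled sums, a Gram matrix in
L², and Gram–Schmidt yields a Gaussian process with this covariance. -/

/-! ### Product measures: relabelling, freezing one coordinate, independence. -/

section ProductMeasure

variable {α V A : Type*} [MeasureSpace α] [IsProbabilityMeasure (volume : Measure α)]
  [Fintype V] [Fintype A]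

lemma iIndepFun_eval_volume : iIndepFun (fun (i : V) (x : V → α) => x i) volume :=
  iIndepFun_pi (X := fun _ x => x) fun _ => aemeasurable_id

lemma measurePreserving_comp_injective {φ : A → V} (hφ : φ.Injective) :
    MeasurePreserving (fun x : V → α => x ∘ φ) volume volume := by
  refine ⟨by fun_prop, ?_⟩
  have h := (iIndepFun_eval_volume (α := α) (V := V)).precomp hφ
  have h' := h.map_fun_eq_pi_map fun i => (measurable_pi_apply (φ i)).aemeasurable
  refine h'.trans ?_
  rw [volume_pi]
  congr 1
  ext1 a
  exact (measurePreserving_eval (fun _ : V => (volume : Measure α)) (φ a)).map_eq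

lemma integral_comp_injective {φ : A → V} (hφ : φ.Injective) {f : (A → α) → ℝ}
    (hf : Measurable f) : ∫ x : V → α, f (x ∘ φ) = ∫ y, f y := by
  have h := measurePreserving_comp_injective (α := α) hφ
  rw [← h.map_eq]
  exact (integral_map h.measurable.aemeasurable hf.aestronglyMeasurable).symm

lemma integral_update_comp_injective [DecidableEq V] [DecidableEq A] {φ : A → V}
    (hφ : φ.Injective) (a : A) (u : α) {f : (A → α) → ℝ} (hf : Measurable f) :
    ∫ x : V → α, f (Function.update x (φ a) u ∘ φ) = ∫ y, f (Function.update y a u) := by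
  simp_rw [Function.update_comp_eq_of_injective _ hφ]
  exact integral_comp_injective hφ (hf.comp measurable_update_left)

/-- Resampling one coordinate independently does not change the law. This is Fubini in the form
suited to `labelledHomDensity`, where the frozen coordinate stays as a dummy variable. -/
lemma measurePreserving_update [DecidableEq V] (v : V) :
    MeasurePreserving (fun p : α × (V → α) => Function.update p.2 v p.1)
      (volume.prod volume) volume := by
  have hm : Measurable fun p : α × (V → α) => Function.update p.2 v p.1 := by
    refine measurable_pi_lambda _ fun i => ?_
    by_cases h : i = v
    · subst h; simpa using measurable_fst
    · simp only [Function.update_of_ne h]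
      fun_prop
  refine ⟨hm, ?_⟩
  rw [volume_pi]
  refine (Measure.pi_eq fun s hs => ?_).symm
  rw [Measure.map_apply hm (.univ_pi hs)]
  have : (fun p : α × (V → α) => Function.update p.2 v p.1) ⁻¹' Set.univ.pi s
      = s v ×ˢ Set.univ.pi (Function.update s v Set.univ) := by
    ext ⟨u, x⟩
    simp only [Set.mem_preimage, Set.mem_univ_pi, Set.mem_prod]
    constructor
    · intro h
      refine ⟨by simpa using h v, fun i => ?_⟩
      by_cases hi : i = v
      · subst hi; simp
      · simpa [Function.update_of_ne hi] using h i
    · rintro ⟨h1, h2⟩ i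
      by_cases hi : i = v
      · subst hi; simpa using h1
      · simpa [Function.update_of_ne hi] using h2 i
  rw [this, Measure.prod_prod, Measure.pi_pi, ← Finset.mul_prod_erase _ _ (Finset.mem_univ v),
    ← Finset.mul_prod_erase _ (fun i => volume (s i)) (Finset.mem_univ v)]
  simp only [Function.update_self, measure_univ, one_mul]
  congr 1
  refine Finset.prod_congr rfl fun i hi => ?_
  rw [Function.update_of_ne (Finset.ne_of_mem_erase hi)]

lemma integral_eq_integral_update [DecidableEq V] (v : V) {f : (V → α) → ℝ}
    (hf : Integrable f) : ∫ x, f x = ∫ u, ∫ x, f (Function.update x v u) := by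
  have h := measurePreserving_update (α := α) v
  calc ∫ x, f x = ∫ p : α × (V → α), f (Function.update p.2 v p.1) := by
        conv_lhs => rw [← h.map_eq]
        exact integral_map h.measurable.aemeasurable
          (by rw [h.map_eq]; exact hf.aestronglyMeasurable)
    _ = _ := integral_prod _ (h.integrable_comp_of_integrable hf)

lemma integral_mul_of_dependsOn_disjoint [DecidableEq V] {f g : (V → α) → ℝ} (hf : Measurable f)
    (hg : Measurable g) {S T : Finset V} (hS : DependsOn f (S : Set V))
    (hT : DependsOn g (T : Set V)) (hST : Disjoint S T) :
    ∫ x, f x * g x = (∫ x, f x) * ∫ x, g x := by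
  obtain ⟨x₀⟩ : Nonempty (V → α) := nonempty_of_isProbabilityMeasure volume
  -- Filling the missing coordinates with an arbitrary point makes `f` and `g` factor through the
  -- restrictions to `S` and `T`, which are independent.
  let ext (U : Finset V) (y : U → α) : V → α := fun i => if h : i ∈ U then y ⟨i, h⟩ else x₀ i
  have hext (U : Finset V) : Measurable (ext U) := by
    refine measurable_pi_lambda _ fun i => ?_
    by_cases h : i ∈ U
    · simpa [ext, h] using measurable_pi_apply _
    · simp [ext, h]
  have key := ((iIndepFun_eval_volume (α := α) (V := V)).indepFun_finset S T hST
    measurable_pi_apply).comp (hf.comp (hext S)) (hg.comp (hext T))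
  have h1 : (f ∘ ext S) ∘ (fun x (i : S) => x i) = f := by
    ext x
    exact hS fun i hi => by simp [ext, Finset.mem_coe.1 hi]
  have h2 : (g ∘ ext T) ∘ (fun x (i : T) => x i) = g := by
    ext x
    exact hT fun i hi => by simp [ext, Finset.mem_coe.1 hi]
  rw [h1, h2] at key
  exact key.integral_fun_mul_eq_mul_integral hf.aestronglyMeasurable hg.aestronglyMeasurable

/-- Once the coordinate `v` is frozen, the two factors depend on disjoint sets of coordinates. Both
the gluing formula and the orthogonality of residuals rest on this. -/
lemma integral_mul_of_dependsOn [DecidableEq V] (v : V) {f g : (V → α) → ℝ} (hf : Measurable f)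
    (hg : Measurable g) (hfg : Integrable fun x => f x * g x) {S T : Finset V}
    (hS : DependsOn f (S : Set V)) (hT : DependsOn g (T : Set V)) (hST : S ∩ T ⊆ {v}) :
    ∫ x, f x * g x
      = ∫ u, (∫ x, f (Function.update x v u)) * ∫ x, g (Function.update x v u) := by
  rw [integral_eq_integral_update v hfg]
  refine integral_congr_ae (ae_of_all _ fun u => ?_)
  have hu : Measurable fun x : V → α => Function.update x v u := measurable_update_left
  have hdep {f : (V → α) → ℝ} {S : Finset V} (hS : DependsOn f (S : Set V)) :
      DependsOn (fun x => f (Function.update x v u)) ((S.erase v : Finset V) : Set V) := by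
    intro x y hxy
    refine hS fun i hi => ?_
    by_cases h : i = v
    · subst h; simp
    · simpa [Function.update_of_ne h] using hxy i (by simpa [h] using hi)
  refine integral_mul_of_dependsOn_disjoint (hf.comp hu) (hg.comp hu) (hdep hS) (hdep hT) ?_
  rw [Finset.disjoint_left]
  intro i hi hi'
  rw [Finset.mem_erase] at hi hi'
  exact hi.1 (Finset.mem_singleton.1 (hST (Finset.mem_inter.2 ⟨hi.2, hi'.2⟩)))

end ProductMeasure

/-! ### Gluing two graphs at a vertex. -/

namespace SimpleGraph

/-- A common edge would have two distinct endpoints in the intersection of the ranges. -/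
lemma disjoint_map_of_range_inter_subset {V A B : Type*} (F : SimpleGraph A) (F' : SimpleGraph B)
    (φ : A ↪ V) (ψ : B ↪ V) {v : V} (h : Set.range φ ∩ Set.range ψ ⊆ {v}) :
    Disjoint (F.map φ) (F'.map ψ) := by
  rw [disjoint_left]
  intro x y hxy hxy'
  rw [map_adj] at hxy hxy'
  obtain ⟨a, b, hab, rfl, rfl⟩ := hxy
  obtain ⟨c, d, hcd, h1, h2⟩ := hxy'
  have e1 := h ⟨⟨a, rfl⟩, ⟨c, h1⟩⟩
  have e2 := h ⟨⟨b, rfl⟩, ⟨d, h2⟩⟩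
  exact hab.ne (φ.injective ((Set.mem_singleton_iff.1 e1).trans (Set.mem_singleton_iff.1 e2).symm))

end SimpleGraph

section Glue

variable {A B : Type*} (q : A) (q' : B)

lemma GlueVertex.mk_inl_injective :
    Function.Injective fun a : A => (Quot.mk (GlueRel q q') (Sum.inl a)) := by
  classical
  -- Collapsing the whole second graph to `q` respects the gluing and gives a left inverse.
  let r : GlueVertex q q' → A := Quot.lift (Sum.elim id fun _ => q) (by rintro _ _ ⟨⟩; rfl)
  exact Function.LeftInverse.injective (g := r) fun a => rfl

lemma GlueVertex.mk_inr_injective :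
    Function.Injective fun b : B => (Quot.mk (GlueRel q q') (Sum.inr b)) := by
  let r : GlueVertex q q' → B := Quot.lift (Sum.elim (fun _ => q') id) (by rintro _ _ ⟨⟩; rfl)
  exact Function.LeftInverse.injective (g := r) fun a => rfl

/-- The embedding of the first vertex set into the glued vertex set. -/
def GlueVertex.inl : A ↪ GlueVertex q q' := ⟨_, GlueVertex.mk_inl_injective q q'⟩

/-- The embedding of the second vertex set into the glued vertex set. -/
def GlueVertex.inr : B ↪ GlueVertex q q' := ⟨_, GlueVertex.mk_inr_injective q q'⟩

lemma GlueVertex.inl_eq_inr : GlueVertex.inl q q' q = GlueVertex.inr q q' q' :=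
  Quot.sound .glue

lemma GlueVertex.range_inter_subset :
    Set.range (GlueVertex.inl q q') ∩ Set.range (GlueVertex.inr q q')
      ⊆ {GlueVertex.inl q q' q} := by
  let r : GlueVertex q q' → A := Quot.lift (Sum.elim id fun _ => q) (by rintro _ _ ⟨⟩; rfl)
  rintro _ ⟨⟨a, rfl⟩, ⟨b, hb⟩⟩
  have h : q = a := congrArg r hb
  subst h
  rfl

/-- The image of a graph under a non-injective map drops loops. None arise here: every edge lies in
one summand, on which the quotient map is injective. -/
lemma SimpleGraph.glue_eq (F : SimpleGraph A) (F' : SimpleGraph B) :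
    F.glue F' q q' = F.map (GlueVertex.inl q q') ⊔ F'.map (GlueVertex.inr q q') := by
  ext x y
  rw [SimpleGraph.glue, SimpleGraph.map_adj', SimpleGraph.sup_adj, SimpleGraph.map_adj,
    SimpleGraph.map_adj]
  constructor
  · rintro ⟨hne, a | a, b | b, hab, rfl, rfl⟩
    · exact .inl ⟨a, b, by simpa using hab, rfl, rfl⟩
    · simp at hab
    · simp at hab
    · exact .inr ⟨a, b, by simpa using hab, rfl, rfl⟩
  · rintro (⟨a, b, hab, rfl, rfl⟩ | ⟨a, b, hab, rfl, rfl⟩)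
    · exact ⟨(GlueVertex.inl q q').injective.ne hab.ne, .inl a, .inl b, by simpa using hab, rfl, rfl⟩
    · exact ⟨(GlueVertex.inr q q').injective.ne hab.ne, .inr a, .inr b, by simpa using hab, rfl, rfl⟩

end Glue

/-! ### Edge products and homomorphism densities. -/

namespace Graphon

variable (W : Graphon) {V A B : Type*}

lemma edgeProd_eq [Finite V] (F : SimpleGraph V) [Fintype F.edgeSet] (x : V → I) :
    W.edgeProd F x = ∏ e ∈ F.edgeFinset, W.edgeWeight x e := by
  unfold edgeProd
  congr!

lemma homDensity_eq [Fintype V] (F : SimpleGraph V) :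
    homDensity F W = ∫ x : V → I, W.edgeProd F x := by
  unfold homDensity
  congr!

lemma labelledHomDensity_eq [Fintype V] [DecidableEq V] (F : SimpleGraph V) (q : V) (u : I) :
    labelledHomDensity F q W u = ∫ x : V → I, W.edgeProd F (Function.update x q u) := by
  unfold labelledHomDensity
  congr!

lemma edgeWeight_comp (φ : A → V) (x : V → I) (e : Sym2 A) :
    W.edgeWeight x (e.map φ) = W.edgeWeight (x ∘ φ) e := by
  induction e with
  | h a b => rfl

lemma edgeProd_map [Finite V] [Finite A] (F : SimpleGraph A) (φ : A ↪ V) (x : V → I) :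
    W.edgeProd (F.map φ) x = W.edgeProd F (x ∘ φ) := by
  classical
  let := Fintype.ofFinite V
  let := Fintype.ofFinite A
  have h : (F.map φ).edgeFinset = F.edgeFinset.map φ.sym2Map := by
    ext e
    simp
  rw [edgeProd_eq, edgeProd_eq, h, Finset.prod_map]
  exact Finset.prod_congr rfl fun e _ => W.edgeWeight_comp φ x e

lemma edgeProd_sup [Finite V] {F F' : SimpleGraph V} (h : Disjoint F F') (x : V → I) :
    W.edgeProd (F ⊔ F') x = W.edgeProd F x * W.edgeProd F' x := by
  classical
  let := Fintype.ofFinite V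
  rw [edgeProd_eq, edgeProd_eq, edgeProd_eq, SimpleGraph.edgeFinset_sup, Finset.prod_union]
  rwa [SimpleGraph.disjoint_edgeFinset]

lemma edgeWeight_mem (x : V → I) (e : Sym2 V) : W.edgeWeight x e ∈ Set.Icc (0 : ℝ) 1 := by
  induction e with
  | h a b => exact (W.toFun (x a) (x b)).2

lemma edgeProd_mem [Finite V] (F : SimpleGraph V) (x : V → I) :
    W.edgeProd F x ∈ Set.Icc (0 : ℝ) 1 := by
  classical
  let := Fintype.ofFinite V
  rw [edgeProd_eq]
  exact ⟨Finset.prod_nonneg fun e _ => (W.edgeWeight_mem x e).1,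
    Finset.prod_le_one (fun e _ => (W.edgeWeight_mem x e).1) fun e _ => (W.edgeWeight_mem x e).2⟩

lemma measurable_edgeWeight (e : Sym2 V) : Measurable fun x : V → I => W.edgeWeight x e := by
  induction e with
  | h a b =>
    have h : Measurable fun x : V → I => ((Function.uncurry W.toFun (x a, x b) : I) : ℝ) :=
      measurable_subtype_coe.comp
        (W.measurable.comp ((measurable_pi_apply a).prodMk (measurable_pi_apply b)))
    exact h

@[fun_prop]
lemma measurable_edgeProd [Finite V] (F : SimpleGraph V) :
    Measurable fun x : V → I => W.edgeProd F x := by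
  classical
  let := Fintype.ofFinite V
  simp_rw [edgeProd_eq]
  exact Finset.measurable_fun_prod _ fun e _ => W.measurable_edgeWeight e

lemma norm_edgeProd_le [Finite V] (F : SimpleGraph V) (x : V → I) :
    ‖W.edgeProd F x‖ ≤ 1 := by
  rw [Real.norm_eq_abs, abs_of_nonneg (W.edgeProd_mem F x).1]
  exact (W.edgeProd_mem F x).2

lemma integrable_edgeProd [Fintype V] (F : SimpleGraph V) :
    Integrable fun x : V → I => W.edgeProd F x :=
  .of_bound (by fun_prop) 1 (ae_of_all _ (W.norm_edgeProd_le F))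

lemma dependsOn_comp [Fintype A] [DecidableEq V] {β : Type*} (f : (A → I) → β) (φ : A → V) :
    DependsOn (fun x : V → I => f (x ∘ φ)) ((Finset.univ.image φ : Finset V) : Set V) := by
  intro x y h
  have : x ∘ φ = y ∘ φ := funext fun a => h _ (by simp)
  simp only [this]

/-- Given the value `u` at the glued vertex, the edge products of the two graphs involve disjoint
sets of variables, so their integrals multiply. -/
lemma homDensity_glue [Fintype A] [Fintype B] (F : SimpleGraph A)
    (F' : SimpleGraph B) (q : A) (q' : B) :
    homDensity (F.glue F' q q') W
      = ∫ u, labelledHomDensity F q W u * labelledHomDensity F' q' W u := by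
  classical
  let := Fintype.ofFinite (GlueVertex q q')
  have h1 (x : GlueVertex q q' → I) : W.edgeProd (F.glue F' q q') x
      = W.edgeProd F (x ∘ GlueVertex.inl q q') * W.edgeProd F' (x ∘ GlueVertex.inr q q') := by
    rw [SimpleGraph.glue_eq, edgeProd_sup, edgeProd_map, edgeProd_map]
    exact SimpleGraph.disjoint_map_of_range_inter_subset _ _ _ _
      (GlueVertex.range_inter_subset q q')
  rw [homDensity_eq]
  simp_rw [h1]
  rw [integral_mul_of_dependsOn (GlueVertex.inl q q' q) (by fun_prop) (by fun_prop) ?_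
    (dependsOn_comp _ _) (dependsOn_comp _ _)]
  · congr 1 with u
    congr 1
    · rw [labelledHomDensity_eq]
      exact integral_update_comp_injective (GlueVertex.inl q q').injective q u (by fun_prop)
    · rw [labelledHomDensity_eq, GlueVertex.inl_eq_inr]
      exact integral_update_comp_injective (GlueVertex.inr q q').injective q' u (by fun_prop)
  · have := GlueVertex.range_inter_subset q q'
    intro v hv
    simp only [Finset.mem_inter, Finset.mem_image, Finset.mem_univ, true_and] at hv
    simpa using this hv
  · simp_rw [← h1]
    exact W.integrable_edgeProd _

lemma labelledHomDensity_mem [Fintype V] (F : SimpleGraph V) (q : V) (u : I) :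
    labelledHomDensity F q W u ∈ Set.Icc (0 : ℝ) 1 := by
  classical
  rw [labelledHomDensity_eq]
  refine ⟨integral_nonneg fun x => (W.edgeProd_mem F _).1, ?_⟩
  refine (integral_mono_of_nonneg (ae_of_all _ fun x => (W.edgeProd_mem F _).1)
    (integrable_const (1 : ℝ)) (ae_of_all _ fun x => (W.edgeProd_mem F _).2)).trans ?_
  simp

@[fun_prop]
lemma measurable_labelledHomDensity [Fintype V] (F : SimpleGraph V) (q : V) :
    Measurable (labelledHomDensity F q W) := by
  classical
  have h : Measurable fun p : I × (V → I) => W.edgeProd F (Function.update p.2 q p.1) :=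
    (W.measurable_edgeProd F).comp (measurePreserving_update q).measurable
  simp_rw [funext (labelledHomDensity_eq W F q)]
  exact h.stronglyMeasurable.integral_prod_right.measurable

lemma integral_labelledHomDensity [Fintype V] (F : SimpleGraph V) (q : V) :
    ∫ u, labelledHomDensity F q W u = homDensity F W := by
  classical
  simp_rw [homDensity_eq, labelledHomDensity_eq]
  exact (integral_eq_integral_update q (W.integrable_edgeProd F)).symm

lemma integrable_labelledHomDensity [Fintype V] (F : SimpleGraph V) (q : V) :
    Integrable (labelledHomDensity F q W) :=
  .of_bound (by fun_prop) 1 (ae_of_all _ fun u => by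
    rw [Real.norm_eq_abs, abs_of_nonneg (W.labelledHomDensity_mem F q u).1]
    exact (W.labelledHomDensity_mem F q u).2)

end Graphon

/-! ### The covariance formula. -/

namespace FinGraph

variable (W : Graphon) (F F' : FinGraph)

@[fun_prop]
lemma measurable_labelledSum : Measurable (F.labelledSum W) := by
  unfold labelledSum
  fun_prop

lemma labelledSum_mem (u : I) : F.labelledSum W u ∈ Set.Icc (0 : ℝ) F.v := by
  refine ⟨Finset.sum_nonneg fun q _ => (W.labelledHomDensity_mem _ q u).1, ?_⟩
  refine (Finset.sum_le_sum fun q _ => (W.labelledHomDensity_mem _ q u).2).trans ?_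
  simp

lemma memLp_labelledSum (p : ENNReal) : MemLp (F.labelledSum W) p := by
  refine MemLp.of_bound (by fun_prop) F.v (ae_of_all _ fun u => ?_)
  rw [Real.norm_eq_abs, abs_of_nonneg (F.labelledSum_mem W u).1]
  exact (F.labelledSum_mem W u).2

lemma integral_labelledSum : ∫ u, F.labelledSum W u = F.v * F.t W := by
  unfold labelledSum
  rw [integral_finsetSum _ fun q _ => W.integrable_labelledHomDensity _ q]
  simp [Graphon.integral_labelledHomDensity, t]

lemma kInj_eq_covariance :
    kInj W F F' = cov[F.labelledSum W, F'.labelledSum W; (volume : Measure I)] := by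
  rw [covariance_eq_sub (F.memLp_labelledSum W 2) (F'.memLp_labelledSum W 2),
    integral_labelledSum, integral_labelledSum, kInj]
  congr 1
  · simp_rw [Graphon.homDensity_glue, Pi.mul_apply, labelledSum, Finset.sum_mul_sum]
    have hi (q : Fin F.v) (q' : Fin F'.v) : Integrable fun u =>
        W.labelledHomDensity F.graph q u * W.labelledHomDensity F'.graph q' u := by
      refine (W.integrable_labelledHomDensity _ _).mul_bdd (c := 1) (by fun_prop)
        (ae_of_all _ fun u => ?_)
      rw [Real.norm_eq_abs, abs_of_nonneg (W.labelledHomDensity_mem _ _ u).1]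
      exact (W.labelledHomDensity_mem _ _ u).2
    rw [integral_finsetSum _ fun q _ => integrable_finsetSum _ fun q' _ => hi q q']
    refine Finset.sum_congr rfl fun q _ => ?_
    rw [integral_finsetSum _ fun q' _ => hi q q']
  · ring

end FinGraph

/-! ### Existence of the limiting Gaussian process. -/

section Gaussian

lemma isGaussianProcess_of_iIndepFun {Ω T : Type*} [MeasurableSpace Ω] {P : Measure Ω}
    {ξ : T → Ω → ℝ} (hξ : iIndepFun ξ P) (h : ∀ t, HasGaussianLaw (ξ t) P) :
    IsGaussianProcess ξ P where
  hasGaussianLaw J :=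
    (hξ.precomp (g := ((↑) : J → T)) Subtype.val_injective).hasGaussianLaw fun i => h i

open scoped InnerProductSpace in
/-- A centered Gaussian sequence whose covariance is the Gram matrix of a given sequence. -/
lemma exists_isGaussianProcess_covariance_eq_inner {E : Type*} [NormedAddCommGroup E]
    [InnerProductSpace ℝ E] (f : ℕ → E) :
    ∃ (Ω : Type) (_ : MeasurableSpace Ω) (P : Measure Ω) (_ : IsProbabilityMeasure P)
      (Θ : ℕ → Ω → ℝ), IsGaussianProcess Θ P ∧ (∀ n, ∫ ω, Θ n ω ∂P = 0) ∧
      ∀ m n, cov[Θ m, Θ n; P] = ⟪f m, f n⟫_ℝ := by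
  obtain ⟨Ω, _, P, ξ, hm, hlaw, hind, hP⟩ := exists_iid ℕ (gaussianReal 0 1)
  have hgauss (k : ℕ) : HasGaussianLaw (ξ k) P := ⟨by rw [(hlaw k).map_eq]; infer_instance⟩
  have hLp (k : ℕ) : MemLp (ξ k) 2 P := (hgauss k).memLp_two
  have hmean (k : ℕ) : ∫ ω, ξ k ω ∂P = 0 := by
    rw [(hlaw k).integral_eq, integral_id_gaussianReal]
  have hcov (k l : ℕ) : cov[ξ k, ξ l; P] = if k = l then 1 else 0 := by
    split_ifs with h
    · subst h
      rw [covariance_self (hm k).aemeasurable, (hlaw k).variance_eq, variance_id_gaussianReal]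
      simp
    · exact (hind.indepFun h).covariance_eq_zero (hLp k) (hLp l)
  let g := InnerProductSpace.gramSchmidt ℝ f
  obtain ⟨c, hc⟩ : ∃ c : ℕ → ℕ → ℝ, ∀ n, f n = ∑ k ∈ Finset.range (n + 1), c n k • g k := by
    -- Linear independence of `f` is not needed: if `g k = 0`, the coefficient is a division by
    -- zero, and it multiplies the zero vector.
    refine ⟨fun n k => if k = n then 1 else ⟪g k, f n⟫_ℝ / ‖g k‖ ^ 2, fun n => ?_⟩
    beta_reduce
    rw [Finset.sum_range_succ, if_pos rfl, one_smul, add_comm]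
    conv_lhs => rw [InnerProductSpace.gramSchmidt_def'' ℝ f n]
    congr 1
    rw [Nat.Iio_eq_range]
    refine Finset.sum_congr rfl fun k hk => ?_
    rw [if_neg (Finset.mem_range.1 hk).ne]
    rfl
  -- The orthogonal vectors `g k` are replaced by the variables `‖g k‖ ξ k`, which have the same
  -- Gram matrix.
  refine ⟨Ω, _, P, hP, fun n ω => ∑ k ∈ Finset.range (n + 1), c n k * ‖g k‖ * ξ k ω, ?_, ?_, ?_⟩
  · refine IsGaussianProcess.of_isGaussianProcess (isGaussianProcess_of_iIndepFun hind hgauss)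
      fun n => ?_
    refine ⟨Finset.range (n + 1),
      ∑ k : Finset.range (n + 1), (c n k * ‖g k‖) • ContinuousLinearMap.proj k, fun ω => ?_⟩
    simp [Finset.sum_attach (Finset.range (n + 1)) (fun k => c n k * ‖g k‖ * ξ k ω)]
  · intro n
    rw [integral_finsetSum _ fun k _ => ((hLp k).integrable (by norm_num)).const_mul _]
    simp [integral_const_mul, hmean]
  · intro m n
    rw [covariance_fun_sum_fun_sum' (fun k _ => (hLp k).const_mul _)
      (fun k _ => (hLp k).const_mul _), hc m, hc n, sum_inner]
    refine Finset.sum_congr rfl fun k _ => ?_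
    rw [inner_sum]
    refine Finset.sum_congr rfl fun l _ => ?_
    rw [covariance_const_mul_left, covariance_const_mul_right, hcov, real_inner_smul_left,
      real_inner_smul_right]
    split_ifs with h
    · subst h
      rw [real_inner_self_eq_norm_sq]
      ring
    · rw [InnerProductSpace.gramSchmidt_orthogonal ℝ f h]
      ring

end Gaussian

namespace FinGraph

lemma countable : Countable FinGraph := by
  have : Function.Injective fun F : FinGraph => (⟨F.v, F.graph⟩ : Σ v, SimpleGraph (Fin v)) := by
    rintro ⟨v, F⟩ ⟨v', F'⟩ h
    simpa using h
  exact this.countable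

open scoped InnerProductSpace in
-- `kInj` is the Gram matrix of the centered labelled sums in L², and the graphs are countable, so
-- they can be indexed by integers.
lemma exists_isGaussianProcess_covariance_eq_kInj (W : Graphon) :
    ∃ (Ω : Type) (_ : MeasurableSpace Ω) (P : Measure Ω) (_ : IsProbabilityMeasure P)
      (Θ : FinGraph → Ω → ℝ), IsGaussianProcess Θ P ∧ (∀ F, ∫ ω, Θ F ω ∂P = 0) ∧
      ∀ F F', cov[Θ F, Θ F'; P] = kInj W F F' := by
  have := countable
  obtain ⟨e, he⟩ := exists_injective_nat FinGraph
  have hLp (F : FinGraph) :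
      MemLp (fun u => F.labelledSum W u - ∫ u, F.labelledSum W u) 2 (volume : Measure I) :=
    (F.memLp_labelledSum W 2).sub (memLp_const _)
  let f (F : FinGraph) : Lp ℝ 2 (volume : Measure I) := (hLp F).toLp
  obtain ⟨Ω, _, P, hP, Θ, h1, h2, h3⟩ :=
    -- Integers that encode no graph receive the zero vector.
    exists_isGaussianProcess_covariance_eq_inner (Function.extend e f 0)
  refine ⟨Ω, _, P, hP, Θ ∘ e, h1.comp_right e, fun F => h2 _, fun F F' => ?_⟩
  rw [kInj_eq_covariance, Function.comp_apply, Function.comp_apply, h3, he.extend_apply,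
    he.extend_apply, L2.inner_def, covariance]
  refine integral_congr_ae ?_
  filter_upwards [(hLp F).coeFn_toLp, (hLp F').coeFn_toLp] with u hu hu'
  simp only [f, hu, hu', RCLike.inner_apply]
  simp [mul_comm]

end FinGraph

/-! ### Integrating out the edges of the random graph given X. -/

lemma integral_sub_sub_add {Ω : Type*} [MeasurableSpace Ω] {P : Measure Ω} {f₁ f₂ f₃ f₄ : Ω → ℝ}
    (h₁ : Integrable f₁ P) (h₂ : Integrable f₂ P) (h₃ : Integrable f₃ P) (h₄ : Integrable f₄ P) :
    ∫ ω, (f₁ ω - f₂ ω - f₃ ω + f₄ ω) ∂P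
      = ∫ ω, f₁ ω ∂P - ∫ ω, f₂ ω ∂P - ∫ ω, f₃ ω ∂P + ∫ ω, f₄ ω ∂P := by
  rw [integral_add (by fun_prop) h₄, integral_sub (by fun_prop) h₃, integral_sub h₁ h₂]

/-- Passes from unordered edges to the pairs `i < j` in which `IsWRandomGraphs` is stated. -/
lemma Graphon.edgeProd_fin_eq (W : Graphon) {n : ℕ} (H : SimpleGraph (Fin n)) [DecidableRel H.Adj]
    (x : Fin n → I) :
    W.edgeProd H x = ∏ e : Fin n × Fin n with e.1 < e.2 ∧ H.Adj e.1 e.2,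
      (W.toFun (x e.1) (x e.2) : ℝ) := by
  rw [Graphon.edgeProd_eq]
  symm
  refine Finset.prod_bij (fun e _ => s(e.1, e.2)) ?_ ?_ ?_ ?_
  · rintro ⟨i, j⟩ h
    simpa using (Finset.mem_filter.1 h).2.2
  · rintro ⟨i, j⟩ h ⟨i', j'⟩ h' heq
    replace h := (Finset.mem_filter.1 h).2.1
    replace h' := (Finset.mem_filter.1 h').2.1
    simp only [Sym2.eq_iff] at heq
    rcases heq with ⟨rfl, rfl⟩ | ⟨rfl, rfl⟩
    · rfl
    · exact absurd h h'.not_gt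
  · intro e he
    induction e with
    | h i j =>
      have hij : H.Adj i j := by simpa using he
      rcases lt_or_gt_of_ne hij.ne with h | h
      · exact ⟨(i, j), by simp [h, hij], rfl⟩
      · exact ⟨(j, i), by simp [h, hij.symm], Sym2.eq_swap⟩
  · rintro ⟨i, j⟩ _
    rfl

namespace IsWRandomGraphs

variable {Ω : Type*} {W : Graphon} {X : ℕ → Ω → I} {G : (n : ℕ) → Ω → SimpleGraph (Fin n)}
variable [MeasurableSpace Ω] {P : Measure Ω}

lemma measurable_comp (h : IsWRandomGraphs P W X G) (n : ℕ) :
    Measurable fun ω (i : Fin n) => X i ω :=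
  measurable_pi_lambda _ fun i => h.measurable_X i

lemma measurableSet_le (h : IsWRandomGraphs P W X G) {n : ℕ} (H : SimpleGraph (Fin n)) :
    MeasurableSet {ω | H ≤ G n ω} := by
  have : {ω | H ≤ G n ω} = ⋂ i, ⋂ j, ⋂ _ : H.Adj i j, {ω | (G n ω).Adj i j} := by
    ext ω
    simp [SimpleGraph.le_iff_adj]
  rw [this]
  exact .iInter fun i => .iInter fun j => .iInter fun _ => h.measurable_adj n i j

lemma map_eq_volume (h : IsWRandomGraphs P W X G) (n : ℕ) :
    P.map (fun ω (i : Fin n) => X i ω) = volume := by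
  have h' : iIndepFun (fun i : Fin n => X i) P := h.indep_X.precomp Fin.val_injective
  rw [iIndepFun.map_fun_eq_pi_map (f := fun i : Fin n => X i)
    (fun i => (h.measurable_X i).aemeasurable) h', volume_pi]
  simp_rw [h.uniform_X]

lemma integral_comp (h : IsWRandomGraphs P W X G) {n : ℕ} {f : (Fin n → I) → ℝ}
    (hf : Measurable f) : ∫ ω, f (fun i => X i ω) ∂P = ∫ x, f x := by
  rw [← h.map_eq_volume n, integral_map (h.measurable_comp n).aemeasurable
    hf.aestronglyMeasurable]

variable [IsProbabilityMeasure P]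

/-- Given X, all edges of `H` are present with probability `edgeProd H`. Since `f` is evaluated at
X, it can be pulled out of the conditional expectation. -/
lemma integral_indicator_le_mul (h : IsWRandomGraphs P W X G) {n : ℕ} (H : SimpleGraph (Fin n))
    {f : (Fin n → I) → ℝ} (hf : Measurable f) {C : ℝ} (hC : ∀ x, ‖f x‖ ≤ C) :
    ∫ ω, {ω | H ≤ G n ω}.indicator 1 ω * f (fun i => X i ω) ∂P = ∫ x, W.edgeProd H x * f x := by
  classical
  have hX : Measurable fun ω i => X i ω := measurable_pi_lambda _ h.measurable_X
  have hm : MeasurableSpace.comap (fun ω i => X i ω) MeasurableSpace.pi ≤ ‹MeasurableSpace Ω› := hX.comap_le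
  let S : Finset (Fin n × Fin n) := {e | e.1 < e.2 ∧ H.Adj e.1 e.2}
  have hS : {ω | ∀ e ∈ S, (G n ω).Adj e.1 e.2} = {ω | H ≤ G n ω} := by
    ext ω
    simp only [Set.mem_ofPred_eq, SimpleGraph.le_iff_adj, S, Finset.mem_filter, Finset.mem_univ,
      true_and, Prod.forall]
    refine ⟨fun hω i j hij => ?_, fun hω i j hij => hω _ _ hij.2⟩
    rcases lt_or_gt_of_ne hij.ne with hlt | hlt
    · exact hω i j ⟨hlt, hij⟩
    · exact (hω j i ⟨hlt, hij.symm⟩).symm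
  have hcond := h.condProb_adj n S fun e he => (Finset.mem_filter.1 he).2.1
  rw [hS] at hcond
  have hfm : StronglyMeasurable[
      MeasurableSpace.comap (fun ω i => X i ω) MeasurableSpace.pi] fun ω => f (fun i : Fin n => X i ω) := by
    have : Measurable fun x : ℕ → I => f (fun i : Fin n => x i) := by fun_prop
    exact (this.comp (comap_measurable _)).stronglyMeasurable
  have hint : Integrable ({ω | H ≤ G n ω}.indicator (1 : Ω → ℝ)) P :=
    (integrable_const (1 : ℝ)).indicator (h.measurableSet_le H)
  have hint' : Integrable
      (({ω | H ≤ G n ω}.indicator (1 : Ω → ℝ)) * fun ω => f (fun i : Fin n => X i ω)) P :=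
    hint.mul_bdd (hfm.mono hm).aestronglyMeasurable (ae_of_all _ fun ω => hC _)
  have hpull := condExp_mul_of_stronglyMeasurable_right hfm hint' hint
  have hprod : Measurable fun x : Fin n → I => W.edgeProd H x * f x := by fun_prop
  rw [← h.integral_comp hprod]
  refine (integral_condExp hm).symm.trans (integral_congr_ae ?_)
  refine hpull.trans ?_
  filter_upwards [hcond] with ω hω
  rw [Pi.mul_apply, Graphon.edgeProd_fin_eq]
  congr 1

end IsWRandomGraphs

/-! ### The projection and the degeneracy of the residual. -/

namespace FinGraph

variable (F F' : FinGraph) (W : Graphon)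

/-- The projection of `Z` on the functions `∑_q f_q(y_q)`. -/
noncomputable def projection (y : Fin F.v → I) : ℝ :=
  F.t W + ∑ q, (W.labelledHomDensity F.graph q (y q) - F.t W)

@[fun_prop]
lemma measurable_projection : Measurable (F.projection W) := by
  unfold projection
  fun_prop

lemma t_mem : F.t W ∈ Set.Icc (0 : ℝ) 1 := by
  rw [t, Graphon.homDensity_eq]
  refine ⟨integral_nonneg fun x => (W.edgeProd_mem _ _).1, ?_⟩
  refine (integral_mono_of_nonneg (ae_of_all _ fun x => (W.edgeProd_mem _ _).1)
    (integrable_const (1 : ℝ)) (ae_of_all _ fun x => (W.edgeProd_mem _ _).2)).trans ?_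
  simp

lemma norm_projection_le (y : Fin F.v → I) : ‖F.projection W y‖ ≤ 1 + F.v := by
  refine (norm_add_le _ _).trans (add_le_add ?_ ((norm_sum_le _ _).trans ?_))
  · rw [Real.norm_eq_abs, abs_le]
    constructor <;> linarith [(F.t_mem W).1, (F.t_mem W).2]
  · refine (Finset.sum_le_sum (g := fun _ => (1 : ℝ)) fun q _ => ?_).trans (by simp)
    have := W.labelledHomDensity_mem F.graph q (y q)
    rw [Real.norm_eq_abs, abs_le]
    constructor <;> linarith [(F.t_mem W).1, (F.t_mem W).2, this.1, this.2]

lemma integrable_projection : Integrable (F.projection W) :=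
  .of_bound (by fun_prop) _ (ae_of_all _ (F.norm_projection_le W))

lemma integrable_labelledHomDensity_eval (q : Fin F.v) :
    Integrable fun y : Fin F.v → I => W.labelledHomDensity F.graph q (y q) :=
  (measurePreserving_eval (fun _ : Fin F.v => (volume : Measure I)) q).integrable_comp_of_integrable
    (W.integrable_labelledHomDensity F.graph q)

lemma integral_labelledHomDensity_eval_sub (q : Fin F.v) :
    ∫ y : Fin F.v → I, (W.labelledHomDensity F.graph q (y q) - F.t W) = 0 := by
  have hm := (measurePreserving_eval (fun _ : Fin F.v => (volume : Measure I)) q)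
  have : ∫ y : Fin F.v → I, W.labelledHomDensity F.graph q (y q) = F.t W := by
    rw [t, ← Graphon.integral_labelledHomDensity W F.graph q, ← hm.map_eq]
    exact (integral_map hm.measurable.aemeasurable (by fun_prop)).symm
  rw [integral_sub (F.integrable_labelledHomDensity_eval W q) (integrable_const _), this]
  simp

lemma integrable_labelledHomDensity_eval_sub (q : Fin F.v) :
    Integrable fun y : Fin F.v → I => W.labelledHomDensity F.graph q (y q) - F.t W :=
  (F.integrable_labelledHomDensity_eval W q).sub (integrable_const _)

lemma integral_edgeProd_sub_projection :
    ∫ y, (W.edgeProd F.graph y - F.projection W y) = 0 := by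
  rw [integral_sub (W.integrable_edgeProd _) (F.integrable_projection W),
    ← Graphon.homDensity_eq]
  unfold projection
  rw [integral_add (integrable_const _)
    (integrable_finsetSum _ fun q _ => F.integrable_labelledHomDensity_eval_sub W q),
    integral_finsetSum _ fun q _ => F.integrable_labelledHomDensity_eval_sub W q,
    Finset.sum_congr rfl fun q _ => F.integral_labelledHomDensity_eval_sub W q]
  simp [t]

/-- With one variable fixed at `u`, the edge product integrates to t_u(F^q). So does the projection:
its term at `q` is t_u(F^q) - t and the others are centered. -/
lemma integral_edgeProd_sub_projection_update (q : Fin F.v) (u : I) :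
    ∫ y, (W.edgeProd F.graph (Function.update y q u) - F.projection W (Function.update y q u))
      = 0 := by
  have hu : Measurable fun y : Fin F.v → I => Function.update y q u := measurable_update_left
  have h1 : Integrable fun y : Fin F.v → I => W.edgeProd F.graph (Function.update y q u) :=
    .of_bound ((W.measurable_edgeProd _).comp hu).aestronglyMeasurable 1
      (ae_of_all _ fun y => W.norm_edgeProd_le _ _)
  have h2 (y : Fin F.v → I) : F.projection W (Function.update y q u)
      = W.labelledHomDensity F.graph q u
        + ∑ q' ∈ Finset.univ.erase q, (W.labelledHomDensity F.graph q' (y q') - F.t W) := by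
    rw [projection, ← Finset.add_sum_erase _ _ (Finset.mem_univ q), Function.update_self,
      Finset.sum_congr rfl fun q' hq' => by
        rw [Function.update_of_ne (Finset.ne_of_mem_erase hq')]]
    ring
  have h3 := integrable_finsetSum (Finset.univ.erase q)
    fun q' _ => F.integrable_labelledHomDensity_eval_sub W q'
  simp_rw [h2]
  rw [integral_sub h1 (by fun_prop), integral_add (integrable_const _) h3,
    integral_finsetSum _ fun q _ => F.integrable_labelledHomDensity_eval_sub W q,
    ← Graphon.labelledHomDensity_eq,
    Finset.sum_congr rfl fun q _ => F.integral_labelledHomDensity_eval_sub W q]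
  simp

/-- `Z` minus its projection. -/
noncomputable def residual (y : Fin F.v → I) : ℝ := W.edgeProd F.graph y - F.projection W y

@[fun_prop]
lemma measurable_residual : Measurable (F.residual W) := by
  unfold residual
  fun_prop

lemma norm_residual_le (y : Fin F.v → I) : ‖F.residual W y‖ ≤ 2 + F.v := by
  refine (norm_sub_le _ _).trans ?_
  linarith [W.norm_edgeProd_le F.graph y, F.norm_projection_le W y]

lemma integral_residual_update_comp {V : Type*} [Fintype V] [DecidableEq V] (φ : Fin F.v ↪ V)
    (v : V) (u : I) : ∫ x : V → I, F.residual W (Function.update x v u ∘ φ) = 0 := by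
  by_cases h : v ∈ Set.range φ
  · obtain ⟨q, rfl⟩ := h
    rw [integral_update_comp_injective φ.injective q u (by fun_prop)]
    exact F.integral_edgeProd_sub_projection_update W q u
  · have (x : V → I) : Function.update x v u ∘ φ = x ∘ φ := by
      ext1 a
      exact Function.update_of_ne (fun hv => h ⟨a, hv⟩) _ _
    simp_rw [this]
    rw [integral_comp_injective φ.injective (by fun_prop)]
    exact F.integral_edgeProd_sub_projection W

/-- Freezing the only possible common coordinate splits the integral into a product, both factors of
which vanish by degeneracy. -/
lemma integral_residual_mul_residual {V : Type*} [Fintype V] (φ : Fin F.v ↪ V)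
    (ψ : Fin F'.v ↪ V) {v : V} (h : Set.range φ ∩ Set.range ψ ⊆ {v}) :
    ∫ x : V → I, F.residual W (x ∘ φ) * F'.residual W (x ∘ ψ) = 0 := by
  classical
  rw [integral_mul_of_dependsOn v (by fun_prop) (by fun_prop) ?_
    (Graphon.dependsOn_comp _ _) (Graphon.dependsOn_comp _ _)]
  · simp [integral_residual_update_comp]
  · intro w hw
    simp only [Finset.mem_inter, Finset.mem_image, Finset.mem_univ, true_and] at hw
    simpa using h hw
  · refine Integrable.of_bound (by fun_prop) ((2 + F.v) * (2 + F'.v)) (ae_of_all _ fun x => ?_)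
    rw [norm_mul]
    exact mul_le_mul (F.norm_residual_le W _) (F'.norm_residual_le W _) (norm_nonneg _)
      (by positivity)

end FinGraph

namespace IsWRandomGraphs

variable {Ω : Type*} [MeasurableSpace Ω] {P : Measure Ω} [IsProbabilityMeasure P] {W : Graphon}
  {X : ℕ → Ω → I} {G : (n : ℕ) → Ω → SimpleGraph (Fin n)}

/-- The two copies of `F` have no common edge, so given X their presences are conditionally
independent. Integrating out the edges leaves the product of two residuals in X alone. -/
lemma integral_residual_mul_eq_zero (h : IsWRandomGraphs P W X G) (F : FinGraph) {n : ℕ}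
    (φ ψ : Fin F.v ↪ Fin n) {v : Fin n} (hv : Set.range φ ∩ Set.range ψ ⊆ {v}) :
    ∫ ω, ({ω | F.graph.map φ ≤ G n ω}.indicator 1 ω - F.projection W fun q => X (φ q) ω)
      * ({ω | F.graph.map ψ ≤ G n ω}.indicator 1 ω - F.projection W fun q => X (ψ q) ω) ∂P = 0 := by
  let p (φ : Fin F.v ↪ Fin n) (x : Fin n → I) : ℝ := F.projection W (x ∘ φ)
  have hp (φ) : Measurable (p φ) := by fun_prop
  have hpb (φ x) : ‖p φ x‖ ≤ 1 + F.v := F.norm_projection_le W _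
  have hpp (x) : ‖p φ x * p ψ x‖ ≤ (1 + F.v) * (1 + F.v) := by
    rw [norm_mul]
    exact mul_le_mul (hpb _ _) (hpb _ _) (norm_nonneg _) (by positivity)
  have hX := h.measurable_comp n
  have hind (H : SimpleGraph (Fin n)) : Integrable ({ω | H ≤ G n ω}.indicator (1 : Ω → ℝ)) P :=
    (integrable_const (1 : ℝ)).indicator (h.measurableSet_le H)
  have hprod (H : SimpleGraph (Fin n)) {f : (Fin n → I) → ℝ} (hf : Measurable f) {C : ℝ}
      (hC : ∀ x, ‖f x‖ ≤ C) :
      Integrable (fun ω => {ω | H ≤ G n ω}.indicator 1 ω * f (fun i => X i ω)) P :=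
    (hind H).mul_bdd (hf.comp hX).aestronglyMeasurable (ae_of_all _ fun ω => hC _)
  have hedge (H : SimpleGraph (Fin n)) {f : (Fin n → I) → ℝ} (hf : Measurable f) {C : ℝ}
      (hC : ∀ x, ‖f x‖ ≤ C) : Integrable (fun x => W.edgeProd H x * f x) :=
    (W.integrable_edgeProd H).mul_bdd hf.aestronglyMeasurable (ae_of_all _ fun ω => hC _)
  let H := F.graph.map φ
  let H' := F.graph.map ψ
  have hdisj : Disjoint H H' := SimpleGraph.disjoint_map_of_range_inter_subset _ _ _ _ hv
  have hone : ∀ x : Fin n → I, ‖(1 : ℝ)‖ ≤ 1 := fun x => by simp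
  -- After expansion each term is a single edge indicator times a function of X, or a function of X
  -- alone; both indicators together say that the union of the two copies is present.
  have e1 (ω) : ({ω | F.graph.map φ ≤ G n ω}.indicator 1 ω - F.projection W fun q => X (φ q) ω)
      * ({ω | F.graph.map ψ ≤ G n ω}.indicator 1 ω - F.projection W fun q => X (ψ q) ω)
      = {ω | H ⊔ H' ≤ G n ω}.indicator 1 ω * (1 : ℝ)
        - {ω | H ≤ G n ω}.indicator 1 ω * p ψ (fun i => X i ω)
        - {ω | H' ≤ G n ω}.indicator 1 ω * p φ (fun i => X i ω)
        + p φ (fun i => X i ω) * p ψ (fun i => X i ω) := by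
    have : {ω | H ⊔ H' ≤ G n ω}.indicator (1 : Ω → ℝ) ω
        = {ω | H ≤ G n ω}.indicator 1 ω * {ω | H' ≤ G n ω}.indicator 1 ω := by
      by_cases h1 : H ≤ G n ω <;> by_cases h2 : H' ≤ G n ω <;> simp [Set.indicator, h1, h2]
    rw [this]
    simp only [p, H, H', Function.comp_def]
    ring
  have e2 (x : Fin n → I) : F.residual W (x ∘ φ) * F.residual W (x ∘ ψ)
      = W.edgeProd (H ⊔ H') x * 1 - W.edgeProd H x * p ψ x - W.edgeProd H' x * p φ x
        + p φ x * p ψ x := by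
    rw [W.edgeProd_sup hdisj, Graphon.edgeProd_map, Graphon.edgeProd_map]
    simp only [FinGraph.residual, p]
    ring
  have i4 : Integrable (fun x : Fin n → I => p φ x * p ψ x) :=
    .of_bound ((hp φ).mul (hp ψ)).aestronglyMeasurable _ (ae_of_all _ hpp)
  have i4' : Integrable (fun ω => p φ (fun i => X i ω) * p ψ (fun i => X i ω)) P :=
    .of_bound (((hp φ).mul (hp ψ)).comp hX).aestronglyMeasurable _ (ae_of_all _ fun ω => hpp _)
  have j1 := hprod (H ⊔ H') measurable_const hone
  have j2 := hprod H (hp ψ) (hpb ψ)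
  have j3 := hprod H' (hp φ) (hpb φ)
  have k1 := hedge (H ⊔ H') measurable_const hone
  have k2 := hedge H (hp ψ) (hpb ψ)
  have k3 := hedge H' (hp φ) (hpb φ)
  rw [← F.integral_residual_mul_residual F W φ ψ hv]
  simp_rw [e1, e2]
  rw [integral_sub_sub_add j1 j2 j3 i4', integral_sub_sub_add k1 k2 k3 i4,
    h.integral_indicator_le_mul (H ⊔ H') measurable_const hone,
    h.integral_indicator_le_mul H (hp ψ) (hpb ψ), h.integral_indicator_le_mul H' (hp φ) (hpb φ)]
  congr 1
  exact h.integral_comp ((hp φ).mul (hp ψ))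

end IsWRandomGraphs

/-! ### Counting embeddings and pairs that share two vertices. -/

section Counting

open Finset

variable {A V : Type*} [Fintype A] [Fintype V] [DecidableEq V]

/-- Permutations of `V` act transitively on its points, so the fibers of φ ↦ φ a all have the same
size. -/
lemma card_embedding_apply_eq (a : A) (i : V) :
    Fintype.card V * #{φ : A ↪ V | φ a = i} = Fintype.card (A ↪ V) := by
  have h (j : V) : #{φ : A ↪ V | φ a = j} = #{φ : A ↪ V | φ a = i} := by
    refine card_equiv (Equiv.embeddingCongr (.refl A) (Equiv.swap j i)) fun φ => ?_
    simp [Equiv.swap_apply_eq_iff]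
  rw [← card_univ (α := A ↪ V), card_eq_sum_card_fiberwise (s := univ)
    (f := fun φ : A ↪ V => φ a) (t := univ) (by simp [Set.MapsTo]), sum_congr rfl fun j _ => h j,
    sum_const, card_univ, smul_eq_mul]

lemma sum_embedding_apply (a : A) (g : V → ℝ) :
    (Fintype.card V : ℝ) * ∑ φ : A ↪ V, g (φ a) = Fintype.card (A ↪ V) * ∑ i, g i := by
  rw [← sum_fiberwise_of_maps_to (t := univ) (g := fun φ : A ↪ V => φ a) (fun _ _ => mem_univ _),
    mul_sum, mul_sum]
  refine sum_congr rfl fun i _ => ?_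
  rw [sum_congr rfl (g := fun _ => g i) fun φ hφ => by rw [(mem_filter.1 hφ).2], sum_const,
    nsmul_eq_mul, ← mul_assoc, ← card_embedding_apply_eq a i, Nat.cast_mul]

lemma card_embedding_apply_eq_and {a b : A} (hab : a ≠ b) {i j : V} (hij : i ≠ j) :
    (Fintype.card V * Fintype.card V - Fintype.card V) * #{φ : A ↪ V | φ a = i ∧ φ b = j}
      = Fintype.card (A ↪ V) := by
  have h (p : V × V) (hp : p ∈ (univ : Finset V).offDiag) :
      #{φ : A ↪ V | (φ a, φ b) = p} = #{φ : A ↪ V | φ a = i ∧ φ b = j} := by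
    obtain ⟨k, l⟩ := p
    have hkl : k ≠ l := by simpa using hp
    -- A permutation taking (k, l) to (i, j): the second swap sends the image of `l` to `j` and
    -- leaves `i` fixed.
    let τ := (Equiv.swap k i).trans (Equiv.swap (Equiv.swap k i l) j)
    have hτl : τ l = j := by simp [τ]
    have hτk : τ k = i := by
      have h1 : i ≠ Equiv.swap k i l := fun h => hkl (by
        rw [eq_comm, Equiv.swap_apply_eq_iff, Equiv.swap_apply_right] at h
        exact h.symm)
      simp [τ, Equiv.swap_apply_of_ne_of_ne h1 hij]
    refine card_equiv (Equiv.embeddingCongr (.refl A) τ) fun φ => ?_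
    have hk (x : V) : τ x = i ↔ x = k :=
      ⟨fun h => τ.injective (h.trans hτk.symm), fun h => h ▸ hτk⟩
    have hl (x : V) : τ x = j ↔ x = l :=
      ⟨fun h => τ.injective (h.trans hτl.symm), fun h => h ▸ hτl⟩
    simp only [mem_filter_univ, Prod.mk.injEq]
    exact and_congr (hk _).symm (hl _).symm
  rw [← card_univ (α := A ↪ V), card_eq_sum_card_fiberwise (s := univ)
    (f := fun φ : A ↪ V => (φ a, φ b)) (t := univ.offDiag) (by
      intro φ _
      simpa using hab), sum_congr rfl h, sum_const, offDiag_card, card_univ, smul_eq_mul]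

/-- Union bound over the quadruples (a, b, c, d), at most |A|⁴ in number. For each of them and each
φ, two values of ψ are prescribed. -/
lemma card_embedding_pairs_le [DecidableEq A] :
    (Fintype.card V * Fintype.card V - Fintype.card V)
        * #{P : (A ↪ V) × (A ↪ V) | ∃ a b c d, a ≠ b ∧ c ≠ d ∧ P.1 a = P.2 c ∧ P.1 b = P.2 d}
      ≤ Fintype.card A ^ 4 * Fintype.card (A ↪ V) ^ 2 := by
  let S : Finset (A × A × A × A) := {t | t.1 ≠ t.2.1 ∧ t.2.2.1 ≠ t.2.2.2}
  let B (t : A × A × A × A) : Finset ((A ↪ V) × (A ↪ V)) :=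
    {P | P.1 t.1 = P.2 t.2.2.1 ∧ P.1 t.2.1 = P.2 t.2.2.2}
  have hsub : ({P : (A ↪ V) × (A ↪ V) | ∃ a b c d, a ≠ b ∧ c ≠ d ∧ P.1 a = P.2 c ∧ P.1 b = P.2 d} :
      Finset _) ⊆ S.biUnion B := by
    intro P hP
    obtain ⟨a, b, c, d, hab, hcd, h1, h2⟩ := (mem_filter.1 hP).2
    exact mem_biUnion.2 ⟨(a, b, c, d), by simp [S, hab, hcd], by simp [B, h1, h2]⟩
  have hB (t) (ht : t ∈ S) : (Fintype.card V * Fintype.card V - Fintype.card V) * #(B t)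
      = Fintype.card (A ↪ V) ^ 2 := by
    obtain ⟨a, b, c, d⟩ := t
    obtain ⟨hab, hcd⟩ : a ≠ b ∧ c ≠ d := by simpa [S] using ht
    have : #(B (a, b, c, d)) = ∑ φ : A ↪ V, #{ψ : A ↪ V | ψ c = φ a ∧ ψ d = φ b} := by
      simp only [B, card_filter, Fintype.sum_prod_type]
      simp only [eq_comm]
    rw [this, mul_sum, sum_congr rfl fun φ _ =>
      card_embedding_apply_eq_and hcd (φ.injective.ne hab), sum_const, card_univ, smul_eq_mul, sq]
  calc _ ≤ (Fintype.card V * Fintype.card V - Fintype.card V) * ∑ t ∈ S, #(B t) :=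
        Nat.mul_le_mul_left _ ((card_le_card hsub).trans card_biUnion_le)
    _ = #S * Fintype.card (A ↪ V) ^ 2 := by
        rw [mul_sum, sum_congr rfl hB, sum_const, smul_eq_mul]
    _ ≤ _ := by
        refine Nat.mul_le_mul_right _ ((card_le_univ _).trans_eq ?_)
        simp only [Fintype.card_prod]
        ring

end Counting

lemma range_inter_subset_singleton {A V : Type*} [Nonempty V] (φ ψ : A ↪ V)
    (h : ¬ ∃ a b c d, a ≠ b ∧ c ≠ d ∧ φ a = ψ c ∧ φ b = ψ d) :
    ∃ v, Set.range φ ∩ Set.range ψ ⊆ {v} := by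
  by_cases hne : (Set.range φ ∩ Set.range ψ).Nonempty
  · obtain ⟨_, ⟨a, rfl⟩, c, hc⟩ := hne
    refine ⟨φ a, ?_⟩
    rintro _ ⟨⟨b, rfl⟩, d, hd⟩
    by_contra hab
    have hne : a ≠ b := fun h => hab (by simp [h])
    refine h ⟨a, b, c, d, hne, ?_, hc.symm, hd.symm⟩
    rintro rfl
    exact hne (φ.injective (hc.symm.trans hd))
  · rw [Set.not_nonempty_iff_eq_empty] at hne
    -- For disjoint ranges any vertex will do.
    exact ⟨Classical.arbitrary V, by simp [hne]⟩

lemma injDensity_eq {A : Type*} [Fintype A] {n : ℕ} (F : SimpleGraph A)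
    (G : SimpleGraph (Fin n)) [DecidablePred fun φ : A ↪ Fin n => F.map φ ≤ G] :
    injDensity F G = (∑ φ : A ↪ Fin n, if F.map φ ≤ G then (1 : ℝ) else 0)
      / Fintype.card (A ↪ Fin n) := by
  have e : SimpleGraph.Copy F G ≃ {φ : A ↪ Fin n // F.map φ ≤ G} :=
    { toFun f := ⟨f.toEmbedding, by
        rintro _ _ h
        obtain ⟨a, b, hab, rfl, rfl⟩ := (SimpleGraph.map_adj _ _ _ _).1 h
        exact f.toHom.map_adj hab⟩
      invFun φ := ⟨⟨φ.1, fun {a b} hab => φ.2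
        ((SimpleGraph.map_adj _ _ _ _).2 ⟨a, b, hab, rfl, rfl⟩)⟩, φ.1.injective⟩
      left_inv f := rfl
      right_inv φ := rfl }
  rw [injDensity, Nat.card_congr e, Nat.card_eq_fintype_card, Nat.card_eq_fintype_card,
    Nat.card_eq_fintype_card, Fintype.card_embedding_eq, Fintype.card_subtype, Finset.sum_boole]

/-! ### The second moment of the remainder. -/

namespace IsWRandomGraphs

variable {Ω : Type*} {W : Graphon} {X : ℕ → Ω → I} {G : (n : ℕ) → Ω → SimpleGraph (Fin n)}

/-- `t_inj(F, G_n)` minus its Hájek projection. -/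
noncomputable def _root_.FinGraph.remainder (W : Graphon) (X : ℕ → Ω → I)
    (G : (n : ℕ) → Ω → SimpleGraph (Fin n)) (F : FinGraph) (n : ℕ) (ω : Ω) : ℝ :=
  F.tInj (G n ω) - F.t W
    - (n : ℝ)⁻¹ * ∑ i ∈ Finset.range n, (F.labelledSum W (X i ω) - F.v * F.t W)

/-- Averaged over embeddings, φ q is uniform on the n vertices, so the average of the projections is
exactly the i.i.d. sum. The bound `hF` ensures that embeddings exist. -/
lemma remainder_eq (F : FinGraph) {n : ℕ} (hn : 0 < n) (hF : F.v ≤ n) (ω : Ω) :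
    F.remainder W X G n ω = (∑ φ : Fin F.v ↪ Fin n,
      ({ω | F.graph.map φ ≤ G n ω}.indicator 1 ω - F.projection W fun q => X (φ q) ω))
        / Fintype.card (Fin F.v ↪ Fin n) := by
  classical
  have hN : (Fintype.card (Fin F.v ↪ Fin n) : ℝ) ≠ 0 := by
    rw [Fintype.card_embedding_eq, Fintype.card_fin, Fintype.card_fin, Nat.cast_ne_zero]
    exact (Nat.descFactorial_pos.2 hF).ne'
  have hn' : (n : ℝ) ≠ 0 := by positivity
  have h1 : ∑ φ : Fin F.v ↪ Fin n, ∑ q,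
        (W.labelledHomDensity F.graph q (X (φ q) ω) - F.t W)
      = Fintype.card (Fin F.v ↪ Fin n) * ((n : ℝ)⁻¹ *
        ∑ i ∈ Finset.range n, (F.labelledSum W (X i ω) - F.v * F.t W)) := by
    rw [Finset.sum_comm]
    have h2 (q : Fin F.v) : ∑ φ : Fin F.v ↪ Fin n,
        (W.labelledHomDensity F.graph q (X (φ q) ω) - F.t W)
        = (n : ℝ)⁻¹ * (Fintype.card (Fin F.v ↪ Fin n) *
          ∑ i : Fin n, (W.labelledHomDensity F.graph q (X i ω) - F.t W)) := by
      rw [← sum_embedding_apply q fun i : Fin n =>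
        W.labelledHomDensity F.graph q (X i ω) - F.t W, Fintype.card_fin, inv_mul_cancel_left₀ hn']
    rw [Finset.sum_congr rfl fun q _ => h2 q, ← Finset.mul_sum, ← Finset.mul_sum, Finset.sum_comm,
      Finset.sum_range fun i => F.labelledSum W (X i ω) - F.v * F.t W]
    simp only [Finset.sum_sub_distrib, FinGraph.labelledSum, Finset.sum_const, Finset.card_univ,
      Fintype.card_fin, nsmul_eq_mul]
    ring
  have h3 : ∑ φ : Fin F.v ↪ Fin n, (F.projection W fun q => X (φ q) ω)
      = Fintype.card (Fin F.v ↪ Fin n) * (F.t W + (n : ℝ)⁻¹ *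
        ∑ i ∈ Finset.range n, (F.labelledSum W (X i ω) - F.v * F.t W)) := by
    simp only [FinGraph.projection]
    rw [Finset.sum_add_distrib, h1, Finset.sum_const, Finset.card_univ, nsmul_eq_mul]
    ring
  rw [FinGraph.remainder, FinGraph.tInj, injDensity_eq]
  generalize ∑ i ∈ Finset.range n, (F.labelledSum W (X i ω) - F.v * F.t W) = S at h3 ⊢
  rw [Finset.sum_sub_distrib, h3, sub_div,
    mul_div_cancel_left₀ _ hN]
  simp only [Set.indicator_apply, Set.mem_ofPred_eq, Pi.one_apply]
  ring

variable [MeasurableSpace Ω] {P : Measure Ω} [IsProbabilityMeasure P]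

/-- In the expanded square only pairs sharing two vertices contribute. They make up at most a
proportion v⁴ / (n(n-1)) of all pairs, and each contributes at most (2 + v)². -/
lemma integral_remainder_sq_le (h : IsWRandomGraphs P W X G) (F : FinGraph) {n : ℕ} (hn : 1 < n)
    (hF : F.v ≤ n) :
    (n * (n - 1) : ℝ) * ∫ ω, F.remainder W X G n ω ^ 2 ∂P ≤ F.v ^ 4 * (2 + F.v) ^ 2 := by
  classical
  have : Nonempty (Fin n) := ⟨⟨0, by omega⟩⟩
  let R (φ : Fin F.v ↪ Fin n) (ω : Ω) : ℝ :=
    {ω | F.graph.map φ ≤ G n ω}.indicator 1 ω - F.projection W fun q => X (φ q) ω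
  have hR (φ) : Measurable (R φ) :=
    (measurable_one.indicator (h.measurableSet_le _)).sub
      ((F.measurable_projection W).comp (measurable_pi_lambda _ fun q => h.measurable_X _))
  have hRb (φ ω) : ‖R φ ω‖ ≤ 2 + F.v := by
    refine (norm_sub_le _ _).trans ?_
    have h1 : ‖{ω | F.graph.map φ ≤ G n ω}.indicator (1 : Ω → ℝ) ω‖ ≤ 1 := by
      refine (norm_indicator_le_norm_self _ _).trans ?_
      simp
    linarith [F.norm_projection_le W fun q => X (φ q) ω]
  have hRR (φ ψ ω) : ‖R φ ω * R ψ ω‖ ≤ (2 + F.v) ^ 2 := by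
    rw [norm_mul, sq]
    exact mul_le_mul (hRb _ _) (hRb _ _) (norm_nonneg _) (by positivity)
  have hi (φ ψ) : Integrable (fun ω => R φ ω * R ψ ω) P :=
    .of_bound ((hR φ).mul (hR ψ)).aestronglyMeasurable _ (ae_of_all _ (hRR φ ψ))
  set N : ℝ := (Fintype.card (Fin F.v ↪ Fin n) : ℝ) with hNdef
  have hN : 0 < N := by
    rw [hNdef, Fintype.card_embedding_eq, Fintype.card_fin, Fintype.card_fin, Nat.cast_pos]
    exact Nat.descFactorial_pos.2 hF
  let bad : Finset ((Fin F.v ↪ Fin n) × (Fin F.v ↪ Fin n)) :=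
    {p | ∃ a b c d, a ≠ b ∧ c ≠ d ∧ p.1 a = p.2 c ∧ p.1 b = p.2 d}
  have hbad : (n * (n - 1) : ℝ) * bad.card ≤ F.v ^ 4 * N ^ 2 := by
    have := card_embedding_pairs_le (A := Fin F.v) (V := Fin n)
    rw [Fintype.card_fin, Fintype.card_fin] at this
    have hcast : ((n * n - n : ℕ) : ℝ) = n * (n - 1) := by
      rw [Nat.cast_sub (Nat.le_mul_self n)]
      push_cast
      ring
    rw [← hcast, hNdef]
    exact_mod_cast this
  have hsq (ω) : F.remainder W X G n ω ^ 2 = (N ^ 2)⁻¹ * ∑ φ, ∑ ψ, R φ ω * R ψ ω := by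
    rw [remainder_eq F (by omega) hF, div_pow, ← Finset.sum_mul_sum, ← sq, div_eq_inv_mul]
  have hsum : ∑ φ, ∑ ψ, ∫ ω, R φ ω * R ψ ω ∂P ≤ bad.card * (2 + F.v) ^ 2 := by
    rw [← Fintype.sum_prod_type' fun φ ψ => ∫ ω, R φ ω * R ψ ω ∂P, ← nsmul_eq_mul,
      ← Finset.sum_const, ← Finset.sum_subset (Finset.subset_univ bad)]
    · refine Finset.sum_le_sum fun p _ => ?_
      refine (le_abs_self _).trans ((norm_integral_le_of_norm_le_const
        (ae_of_all _ (hRR p.1 p.2))).trans_eq ?_)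
      simp
    · intro p _ hp
      obtain ⟨v, hv⟩ := range_inter_subset_singleton p.1 p.2
        fun hb => hp (Finset.mem_filter.2 ⟨Finset.mem_univ _, hb⟩)
      exact h.integral_residual_mul_eq_zero F p.1 p.2 hv
  simp_rw [hsq]
  rw [integral_const_mul, integral_finsetSum _ fun φ _ => integrable_finsetSum _ fun ψ _ => hi φ ψ,
    Finset.sum_congr rfl fun φ _ => integral_finsetSum _ fun ψ _ => hi φ ψ]
  have hn1 : (0 : ℝ) ≤ n * (n - 1) := by
    have : (1 : ℝ) < n := by exact_mod_cast hn
    nlinarith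
  calc _ = (N ^ 2)⁻¹ * ((n * (n - 1) : ℝ) * ∑ φ, ∑ ψ, ∫ ω, R φ ω * R ψ ω ∂P) := by ring
    _ ≤ (N ^ 2)⁻¹ * ((n * (n - 1) : ℝ) * (bad.card * (2 + F.v) ^ 2)) := by gcongr
    _ = (N ^ 2)⁻¹ * (((n * (n - 1) : ℝ) * bad.card) * (2 + F.v) ^ 2) := by ring
    _ ≤ (N ^ 2)⁻¹ * ((F.v ^ 4 * N ^ 2) * (2 + F.v) ^ 2) := by gcongr
    _ = _ := by field_simp

end IsWRandomGraphs

/-! ### Tools for convergence in distribution. -/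

section Convergence

open scoped Topology

lemma tendstoInMeasure_zero_of_tendsto_integral_sq {Ω : Type*} [MeasurableSpace Ω] {P : Measure Ω}
    [IsProbabilityMeasure P] {f : ℕ → Ω → ℝ} (hf : ∀ n, MemLp (f n) 2 P)
    (h : Tendsto (fun n => ∫ ω, f n ω ^ 2 ∂P) atTop (𝓝 0)) :
    TendstoInMeasure P f atTop fun _ => 0 := by
  rw [tendstoInMeasure_iff_measureReal_norm]
  intro ε hε
  refine squeeze_zero (fun n => measureReal_nonneg) (fun n => ?_)
    (by simpa using h.const_mul (ε ^ 2)⁻¹)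
  have hM := mul_meas_ge_le_integral_of_nonneg (ae_of_all P fun ω => sq_nonneg (f n ω))
    (hf n).integrable_sq (ε ^ 2)
  have hset : {ω | ε ≤ ‖f n ω - 0‖} = {ω | ε ^ 2 ≤ f n ω ^ 2} := by
    ext ω
    simp only [sub_zero, Real.norm_eq_abs, Set.mem_ofPred_eq]
    rw [sq_le_sq, abs_of_pos hε]
  rw [hset, inv_mul_eq_div, le_div_iff₀' (by positivity)]
  exact hM

/-- Reduces multivariate characteristic functions to those of linear forms, the core of the
Cramér–Wold device. -/
lemma charFun_map_toLp {Ω J : Type*} [Fintype J] [MeasurableSpace Ω] {P : Measure Ω}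
    {Y : Ω → J → ℝ} (hY : AEMeasurable Y P) (t : EuclideanSpace ℝ J) :
    charFun (P.map fun ω => WithLp.toLp 2 (Y ω)) t
      = charFun (P.map fun ω => ∑ j, t j * Y ω j) 1 := by
  have h1 : AEMeasurable (fun ω => WithLp.toLp 2 (Y ω)) P := by fun_prop
  have h2 : AEMeasurable (fun ω => ∑ j, t j * Y ω j) P := by fun_prop
  rw [charFun_apply, charFun_apply, integral_map h1 (by fun_prop), integral_map h2 (by fun_prop)]
  congr 1 with ω
  simp [PiLp.inner_apply]

/-- The Cramér–Wold device. -/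
lemma tendstoInDistribution_of_forall_linear {Ω Ω' J : Type*} [Fintype J] [MeasurableSpace Ω]
    [MeasurableSpace Ω'] {P : Measure Ω} [IsProbabilityMeasure P] {P' : Measure Ω'}
    [IsProbabilityMeasure P'] {Y : ℕ → Ω → J → ℝ} {Z : Ω' → J → ℝ}
    (hY : ∀ n, AEMeasurable (Y n) P) (hZ : AEMeasurable Z P')
    (h : ∀ c : J → ℝ, TendstoInDistribution (fun n ω => ∑ j, c j * Y n ω j) atTop
      (fun ω => ∑ j, c j * Z ω j) (fun _ => P) P') :
    TendstoInDistribution Y atTop Z (fun _ => P) P' := by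
  have key : TendstoInDistribution (fun n ω => WithLp.toLp 2 (Y n ω)) atTop
      (fun ω => WithLp.toLp 2 (Z ω)) (fun _ => P) P' := by
    refine ⟨fun n => by have := hY n; fun_prop, by fun_prop, ?_⟩
    refine ProbabilityMeasure.tendsto_of_tendsto_charFun fun t => ?_
    have ht := ProbabilityMeasure.tendsto_iff_tendsto_charFun.1 (h t).tendsto 1
    simpa only [ProbabilityMeasure.coe_mk, charFun_map_toLp (hY _), charFun_map_toLp hZ] using ht
  exact key.continuous_comp (g := fun x : EuclideanSpace ℝ J => x.ofLp) (by fun_prop)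

/-- Only the law of the limit matters, so the limit variable may be moved to another probability
space. -/
lemma MeasureTheory.TendstoInDistribution.of_map_eq {Ω Ω' Ω'' : Type*} [MeasurableSpace Ω] [MeasurableSpace Ω']
    [MeasurableSpace Ω''] {P : Measure Ω} [IsProbabilityMeasure P] {P' : Measure Ω'}
    [IsProbabilityMeasure P'] {P'' : Measure Ω''} [IsProbabilityMeasure P''] {Y : ℕ → Ω → ℝ}
    {Z : Ω' → ℝ} {Z' : Ω'' → ℝ} (h : TendstoInDistribution Y atTop Z (fun _ => P) P')
    (hZ' : AEMeasurable Z' P'') (heq : P'.map Z = P''.map Z') :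
    TendstoInDistribution Y atTop Z' (fun _ => P) P'' := by
  refine ⟨h.forall_aemeasurable, hZ', ?_⟩
  have : (⟨P'.map Z, Measure.isProbabilityMeasure_map h.aemeasurable_limit⟩ : ProbabilityMeasure ℝ)
      = ⟨P''.map Z', Measure.isProbabilityMeasure_map hZ'⟩ := Subtype.ext heq
  rw [← this]
  exact h.tendsto

end Convergence

/-! ### Variances and linear combinations of graphs. -/

namespace QuantumGraph

variable (A : QuantumGraph) (W : Graphon)

/-- `∑_m a_m ∑_q t_u(F_m^q, W)`. -/
noncomputable def labelledSum (u : I) : ℝ := A.sum fun F a => a * F.labelledSum W u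

@[fun_prop]
lemma measurable_labelledSum : Measurable (A.labelledSum W) := by
  unfold labelledSum Finsupp.sum
  fun_prop

lemma memLp_labelledSum : MemLp (A.labelledSum W) 2 :=
  memLp_finsetSum _ fun F _ => (F.memLp_labelledSum W 2).const_mul _

lemma integral_labelledSum :
    ∫ u, A.labelledSum W u = A.sum fun F a => a * (F.v * F.t W) := by
  unfold labelledSum Finsupp.sum
  rw [integral_finsetSum _ fun F _ => ((F.memLp_labelledSum W 1).integrable le_rfl).const_mul _]
  simp [integral_const_mul, FinGraph.integral_labelledSum]

lemma sum_kInj_eq_variance :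
    (A.sum fun F a => A.sum fun F' a' => a * a' * FinGraph.kInj W F F')
      = Var[A.labelledSum W; (volume : Measure I)] := by
  rw [← covariance_self (by fun_prop)]
  unfold labelledSum Finsupp.sum
  rw [covariance_fun_sum_fun_sum' (fun F _ => (F.memLp_labelledSum W 2).const_mul _)
    fun F _ => (F.memLp_labelledSum W 2).const_mul _]
  refine Finset.sum_congr rfl fun F _ => Finset.sum_congr rfl fun F' _ => ?_
  rw [covariance_const_mul_left, covariance_const_mul_right, ← FinGraph.kInj_eq_covariance]
  ring

/-- The quantum graph with prescribed coefficients on a finite set of graphs. -/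
noncomputable def ofFinset (J : Finset FinGraph) (c : J → ℝ) : QuantumGraph :=
  ∑ F : J, Finsupp.single F.1 (c F)

/-- Some `c F` may vanish, so the support can be smaller than `J`; linearity avoids comparing the
two. -/
lemma sum_ofFinset (J : Finset FinGraph) (c : J → ℝ) (f : FinGraph → ℝ) :
    ((ofFinset J c).sum fun F a => a * f F) = ∑ F : J, c F * f F.1 := by
  have h := Finsupp.linearCombination_apply ℝ (v := f) (ofFinset J c)
  simp only [smul_eq_mul] at h
  rw [← h, ofFinset, map_sum]
  simp only [Finsupp.linearCombination_single, smul_eq_mul]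

lemma sum_sum_ofFinset (J : Finset FinGraph) (c : J → ℝ) (k : FinGraph → FinGraph → ℝ) :
    ((ofFinset J c).sum fun F a => (ofFinset J c).sum fun F' a' => a * a' * k F F')
      = ∑ F : J, ∑ F' : J, c F * (c F' * k F.1 F'.1) := by
  have h (F : FinGraph) (a : ℝ) : ((ofFinset J c).sum fun F' a' => a * a' * k F F')
      = a * ∑ F' : J, c F' * k F F'.1 := by
    rw [← sum_ofFinset, Finsupp.mul_sum]
    simp only [mul_assoc]
  simp only [h]
  rw [sum_ofFinset]
  simp only [Finset.mul_sum]

end QuantumGraph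

/-! ### The central limit theorem and the finite-dimensional distributions. -/

namespace IsWRandomGraphs

open scoped Topology

variable {Ω : Type*} {W : Graphon} {X : ℕ → Ω → I} {G : (n : ℕ) → Ω → SimpleGraph (Fin n)}

/-- The rescaled remainder of a quantum graph. -/
noncomputable def _root_.QuantumGraph.remainder (A : QuantumGraph) (W : Graphon) (X : ℕ → Ω → I)
    (G : (n : ℕ) → Ω → SimpleGraph (Fin n)) (n : ℕ) (ω : Ω) : ℝ :=
  ∑ F ∈ A.support, A F * (√n * F.remainder W X G n ω)

lemma sqrt_mul_tInj_sub_eq (A : QuantumGraph) (n : ℕ) (ω : Ω) :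
    √(n : ℝ) * (A.tInj (G n ω) - A.t W)
      = (√(n : ℝ))⁻¹ * (∑ k ∈ Finset.range n, A.labelledSum W (X k ω)
          - n * ∫ u, A.labelledSum W u) + A.remainder W X G n ω := by
  -- This holds at n = 0 as well, both sides being 0.
  have hn : √(n : ℝ) * (n : ℝ)⁻¹ = (√(n : ℝ))⁻¹ := by
    rw [← div_eq_mul_inv, Real.sqrt_div_self', one_div]
  have h1 : ∑ k ∈ Finset.range n, A.labelledSum W (X k ω) - n * ∫ u, A.labelledSum W u
      = ∑ F ∈ A.support, A F *
        ∑ i ∈ Finset.range n, (F.labelledSum W (X i ω) - F.v * F.t W) := by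
    rw [QuantumGraph.integral_labelledSum]
    unfold QuantumGraph.labelledSum Finsupp.sum
    rw [Finset.sum_comm, Finset.mul_sum, ← Finset.sum_sub_distrib]
    refine Finset.sum_congr rfl fun F _ => ?_
    rw [← Finset.mul_sum, Finset.sum_sub_distrib, Finset.sum_const, Finset.card_range,
      nsmul_eq_mul]
    ring
  rw [h1, QuantumGraph.tInj, QuantumGraph.t, QuantumGraph.remainder, Finsupp.sum, Finsupp.sum,
    ← Finset.sum_sub_distrib, Finset.mul_sum, Finset.mul_sum, ← Finset.sum_add_distrib]
  refine Finset.sum_congr rfl fun F _ => ?_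
  rw [FinGraph.remainder, ← hn]
  ring

variable [MeasurableSpace Ω] {P : Measure Ω}

lemma measurePreserving_X (h : IsWRandomGraphs P W X G) (i : ℕ) :
    MeasurePreserving (X i) P volume :=
  ⟨h.measurable_X i, h.uniform_X i⟩

lemma measurable_tInj (h : IsWRandomGraphs P W X G) (F : FinGraph) (n : ℕ) :
    Measurable fun ω => F.tInj (G n ω) := by
  classical
  unfold FinGraph.tInj
  simp_rw [injDensity_eq]
  refine (Finset.measurable_fun_sum _ fun φ _ => ?_).div_const _
  exact Measurable.ite (h.measurableSet_le _) measurable_const measurable_const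

variable [IsProbabilityMeasure P]

lemma memLp_tInj (h : IsWRandomGraphs P W X G) (F : FinGraph) (n : ℕ) :
    MemLp (fun ω => F.tInj (G n ω)) 2 P := by
  obtain ⟨C, hC⟩ := (Set.finite_range fun H : SimpleGraph (Fin n) => ‖F.tInj H‖).bddAbove
  exact .of_bound (h.measurable_tInj F n).aestronglyMeasurable C
    (ae_of_all _ fun ω => hC ⟨G n ω, rfl⟩)

lemma memLp_remainder (h : IsWRandomGraphs P W X G) (F : FinGraph) (n : ℕ) :
    MemLp (F.remainder W X G n) 2 P := by
  have h1 : MemLp (fun ω => ∑ i ∈ Finset.range n, (F.labelledSum W (X i ω) - F.v * F.t W)) 2 P :=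
    memLp_finsetSum _ fun i _ => ((F.memLp_labelledSum W 2).comp_measurePreserving
      (h.measurePreserving_X i)).sub (memLp_const _)
  exact ((h.memLp_tInj F n).sub (memLp_const _)).sub (h1.const_mul _)

lemma tendsto_integral_remainder_sq (h : IsWRandomGraphs P W X G) (F : FinGraph) :
    Tendsto (fun n : ℕ => n * ∫ ω, F.remainder W X G n ω ^ 2 ∂P) atTop (𝓝 0) := by
  have hlim : Tendsto (fun n : ℕ => (F.v ^ 4 * (2 + F.v) ^ 2 : ℝ) / ((n : ℝ) - 1)) atTop (𝓝 0) :=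
    (tendsto_atTop_add_const_right _ (-1) tendsto_natCast_atTop_atTop).const_div_atTop _
  refine squeeze_zero' (.of_forall fun n => ?_) ?_ hlim
  · exact mul_nonneg n.cast_nonneg (integral_nonneg fun ω => sq_nonneg _)
  · filter_upwards [eventually_gt_atTop 1, eventually_ge_atTop F.v] with n hn hF
    have hn' : (1 : ℝ) < n := by exact_mod_cast hn
    rw [le_div_iff₀ (by linarith)]
    refine le_trans (le_of_eq ?_) (h.integral_remainder_sq_le F hn hF)
    ring

lemma memLp_quantumRemainder (h : IsWRandomGraphs P W X G) (A : QuantumGraph) (n : ℕ) :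
    MemLp (A.remainder W X G n) 2 P :=
  memLp_finsetSum _ fun F _ => ((h.memLp_remainder F n).const_mul _).const_mul _

/-- Cauchy–Schwarz over the support reduces the second moment to those of the individual graphs. -/
lemma tendstoInMeasure_quantumRemainder (h : IsWRandomGraphs P W X G) (A : QuantumGraph) :
    TendstoInMeasure P (A.remainder W X G) atTop fun _ => 0 := by
  refine tendstoInMeasure_zero_of_tendsto_integral_sq (h.memLp_quantumRemainder A) ?_
  have hlim : Tendsto (fun n : ℕ => (A.support.card : ℝ) *
      ∑ F ∈ A.support, A F ^ 2 * (n * ∫ ω, F.remainder W X G n ω ^ 2 ∂P)) atTop (𝓝 0) := by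
    simpa using (tendsto_finsetSum A.support fun F _ =>
      (h.tendsto_integral_remainder_sq F).const_mul (A F ^ 2)).const_mul (A.support.card : ℝ)
  refine squeeze_zero (fun n => integral_nonneg fun ω => sq_nonneg _) (fun n => ?_) hlim
  have hsq (F : FinGraph) (ω : Ω) : (A F * (√n * F.remainder W X G n ω)) ^ 2
      = A F ^ 2 * (n * F.remainder W X G n ω ^ 2) := by
    rw [mul_pow, mul_pow, Real.sq_sqrt n.cast_nonneg]
  have hint (F : FinGraph) :
      Integrable (fun ω => A F ^ 2 * (n * F.remainder W X G n ω ^ 2)) P :=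
    ((h.memLp_remainder F n).integrable_sq.const_mul _).const_mul _
  calc ∫ ω, A.remainder W X G n ω ^ 2 ∂P
      ≤ ∫ ω, (A.support.card : ℝ) *
          ∑ F ∈ A.support, A F ^ 2 * (n * F.remainder W X G n ω ^ 2) ∂P := by
        refine integral_mono (h.memLp_quantumRemainder A n).integrable_sq
          ((integrable_finsetSum _ fun F _ => hint F).const_mul _) fun ω => ?_
        simp only [← hsq]
        exact sq_sum_le_card_mul_sum_sq
    _ = _ := by
        rw [integral_const_mul, integral_finsetSum _ fun F _ => hint F]
        simp_rw [integral_const_mul]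

/-- The central limit theorem for quantum graphs. -/
lemma tendstoInDistribution_tInj (h : IsWRandomGraphs P W X G) (A : QuantumGraph) :
    TendstoInDistribution (fun (n : ℕ) ω => √(n : ℝ) * (A.tInj (G n ω) - A.t W)) atTop
      (id : ℝ → ℝ) (fun _ => P)
      (gaussianReal 0 Var[A.labelledSum W; (volume : Measure I)].toNNReal) := by
  have hvar : Var[fun ω => A.labelledSum W (X 0 ω); P]
      = Var[A.labelledSum W; (volume : Measure I)] :=
    (h.measurePreserving_X 0).variance_fun_comp (by fun_prop)
  have hmean : ∫ ω, A.labelledSum W (X 0 ω) ∂P = ∫ u, A.labelledSum W u := by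
    rw [← h.uniform_X 0, integral_map (h.measurable_X 0).aemeasurable (by fun_prop)]
  have hid (i : ℕ) : IdentDistrib (X i) (X 0) P P :=
    ⟨(h.measurable_X i).aemeasurable, (h.measurable_X 0).aemeasurable, by
      rw [h.uniform_X, h.uniform_X]⟩
  have hclt := tendstoInDistribution_inv_sqrt_mul_sum_sub (P := P)
    (P' := gaussianReal 0 Var[A.labelledSum W; (volume : Measure I)].toNNReal)
    (X := fun k ω => A.labelledSum W (X k ω)) (Y := (id : ℝ → ℝ))
    (by rw [hvar]; exact HasLaw.id)
    ((A.memLp_labelledSum W).comp_measurePreserving (h.measurePreserving_X 0))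
    (h.indep_X.comp (fun _ => A.labelledSum W) fun _ => by fun_prop)
    (fun i => (hid i).comp (A.measurable_labelledSum W))
  rw [hmean] at hclt
  -- Slutsky's lemma: the rescaled remainder tends to 0 in probability.
  have hadd := hclt.add_of_tendstoInMeasure_const (h.tendstoInMeasure_quantumRemainder A)
    fun n => (h.memLp_quantumRemainder A n).aestronglyMeasurable.aemeasurable
  refine hadd.congr (fun n => ae_of_all _ fun ω => ?_) (ae_of_all _ fun x => add_zero _)
  exact (sqrt_mul_tInj_sub_eq A n ω).symm

/-- A linear form in the coordinates is the density of a quantum graph, to which the one-dimensional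
theorem applies. The same form in Θ is Gaussian with the matching variance. -/
lemma tendstoInDistribution_finset (h : IsWRandomGraphs P W X G) {Ω' : Type*} [MeasurableSpace Ω']
    {P' : Measure Ω'} [IsProbabilityMeasure P'] {Θ : FinGraph → Ω' → ℝ}
    (hΘ : IsGaussianProcess Θ P') (hmean : ∀ F, ∫ ω, Θ F ω ∂P' = 0)
    (hcov : ∀ F F', cov[Θ F, Θ F'; P'] = FinGraph.kInj W F F') (J : Finset FinGraph) :
    TendstoInDistribution
      (fun (n : ℕ) ω (F : J) => √(n : ℝ) * (F.1.tInj (G n ω) - F.1.t W)) atTop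
      (fun ω (F : J) => Θ F.1 ω) (fun _ => P) P' := by
  have hΘm (F : FinGraph) : AEMeasurable (Θ F) P' := hΘ.aemeasurable F
  have hΘL (F : FinGraph) : MemLp (Θ F) 2 P' := (hΘ.hasGaussianLaw_eval F).memLp_two
  have hm (F : FinGraph) (n : ℕ) : Measurable fun ω => √(n : ℝ) * (F.tInj (G n ω) - F.t W) :=
    ((h.measurable_tInj F n).sub_const _).const_mul _
  have hY (n : ℕ) : AEMeasurable (fun ω (F : J) => √(n : ℝ) * (F.1.tInj (G n ω) - F.1.t W)) P := by
    refine Measurable.aemeasurable ?_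
    rw [measurable_pi_iff]
    exact fun F => hm F.1 n
  have hZ : AEMeasurable (fun ω (F : J) => Θ F.1 ω) P' :=
    aemeasurable_pi_lambda _ fun F => hΘm F.1
  refine tendstoInDistribution_of_forall_linear hY hZ fun c => ?_
  let A := QuantumGraph.ofFinset J c
  have hsum : AEMeasurable (fun ω => ∑ F : J, c F * Θ F.1 ω) P' :=
    Finset.aemeasurable_fun_sum _ fun F _ => (hΘm F.1).const_mul _
  have hgauss : HasGaussianLaw (fun ω => ∑ F : J, c F * Θ F.1 ω) P' := by
    let L : (J → ℝ) →L[ℝ] ℝ := ∑ F : J, c F • ContinuousLinearMap.proj F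
    have hL : (fun ω => ∑ F : J, c F * Θ F.1 ω) = L ∘ fun ω => J.restrict (Θ · ω) := by
      ext ω
      simp [L]
    rw [hL]
    exact (hΘ.hasGaussianLaw J).map L
  have hlaw : P'.map (fun ω => ∑ F : J, c F * Θ F.1 ω)
      = gaussianReal 0 Var[A.labelledSum W; (volume : Measure I)].toNNReal := by
    rw [hgauss.map_eq_gaussianReal]
    congr 2
    · rw [integral_finsetSum _ fun F _ => ((hΘL F.1).integrable (by norm_num)).const_mul _]
      simp only [integral_const_mul, hmean, mul_zero, Finset.sum_const_zero]
    · rw [← covariance_self hsum, covariance_fun_sum_fun_sum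
        (fun F : J => (hΘL F.1).const_mul (c F)) (fun F : J => (hΘL F.1).const_mul (c F)),
        ← QuantumGraph.sum_kInj_eq_variance, QuantumGraph.sum_sum_ofFinset]
      simp only [covariance_const_mul_left, covariance_const_mul_right, hcov]
      exact Finset.sum_congr rfl fun F _ => Finset.sum_congr rfl fun F' _ => by ring
  have key := (h.tendstoInDistribution_tInj A).of_map_eq hsum (by rw [Measure.map_id, hlaw])
  convert key using 3 with n ω
  simp only [QuantumGraph.tInj, QuantumGraph.t, A, QuantumGraph.sum_ofFinset]
  rw [← Finset.sum_sub_distrib, Finset.mul_sum]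
  exact Finset.sum_congr rfl fun F _ => by ring

end IsWRandomGraphs

theorem corollary3p3 (W : Graphon) :
    -- the two expressions of the covariance function agree
    (∀ F F' : FinGraph, FinGraph.kInj W F F'
        = cov[F.labelledSum W, F'.labelledSum W; (volume : Measure I)]) ∧
    -- the limiting Gaussian process exists, and the finite-dimensional distributions converge
    (∃ (Ω' : Type) (_ : MeasurableSpace Ω') (P' : Measure Ω') (_ : IsProbabilityMeasure P')
        (Θ : FinGraph → Ω' → ℝ),
      IsGaussianProcess Θ P' ∧
      (∀ F, ∫ ω, Θ F ω ∂P' = 0) ∧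
      (∀ F F', cov[Θ F, Θ F'; P'] = FinGraph.kInj W F F') ∧
      ∀ {Ω : Type*} [MeasurableSpace Ω] (P : Measure Ω) [IsProbabilityMeasure P]
        (X : ℕ → Ω → I) (G : (n : ℕ) → Ω → SimpleGraph (Fin n)), IsWRandomGraphs P W X G →
        ∀ J : Finset FinGraph,
          TendstoInDistribution
            (fun (n : ℕ) ω (F : J) => √(n : ℝ) * (F.1.tInj (G n ω) - F.1.t W)) atTop
            (fun ω (F : J) => Θ F.1 ω) (fun _ => P) P') ∧
    -- the one-dimensional central limit theorem
    (∀ F : FinGraph, ∃ s : ℝ≥0, (s : ℝ) = FinGraph.kInj W F F ∧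
      ∀ {Ω : Type*} [MeasurableSpace Ω] (P : Measure Ω) [IsProbabilityMeasure P]
        (X : ℕ → Ω → I) (G : (n : ℕ) → Ω → SimpleGraph (Fin n)), IsWRandomGraphs P W X G →
        TendstoInDistribution (fun (n : ℕ) ω => √(n : ℝ) * (F.tInj (G n ω) - F.t W)) atTop
          (id : ℝ → ℝ) (fun _ => P) (gaussianReal 0 s)) ∧
    -- the central limit theorem for quantum graphs
    (∀ A : QuantumGraph, ∃ s : ℝ≥0,
      (s : ℝ) = A.sum (fun F a => A.sum fun F' a' => a * a' * FinGraph.kInj W F F') ∧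
      (s : ℝ) = Var[fun u => A.sum fun F a => a * F.labelledSum W u; (volume : Measure I)] ∧
      ∀ {Ω : Type*} [MeasurableSpace Ω] (P : Measure Ω) [IsProbabilityMeasure P]
        (X : ℕ → Ω → I) (G : (n : ℕ) → Ω → SimpleGraph (Fin n)), IsWRandomGraphs P W X G →
        TendstoInDistribution (fun (n : ℕ) ω => √(n : ℝ) * (A.tInj (G n ω) - A.t W)) atTop
          (id : ℝ → ℝ) (fun _ => P) (gaussianReal 0 s)) := by
  have hcoe (A : QuantumGraph) :
      (Var[A.labelledSum W; (volume : Measure I)].toNNReal : ℝ) = Var[A.labelledSum W; volume] :=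
    Real.coe_toNNReal _ (variance_nonneg _ _)
  refine ⟨FinGraph.kInj_eq_covariance W, ?_, fun F => ?_, fun A => ?_⟩
  · obtain ⟨Ω', _, P', hP', Θ, hΘ, hmean, hcov⟩ :=
      FinGraph.exists_isGaussianProcess_covariance_eq_kInj W
    refine ⟨Ω', _, P', hP', Θ, hΘ, hmean, hcov, fun P _ X G h J => ?_⟩
    exact h.tendstoInDistribution_finset hΘ hmean hcov J
  -- A single graph is treated as a quantum graph with one coefficient 1.
  · refine ⟨Var[QuantumGraph.labelledSum (Finsupp.single F 1) W; (volume : Measure I)].toNNReal, ?_,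
      fun P _ X G h => ?_⟩
    · rw [hcoe, ← QuantumGraph.sum_kInj_eq_variance, Finsupp.sum_single_index (by simp),
        Finsupp.sum_single_index (by simp)]
      ring
    · refine (h.tendstoInDistribution_tInj (Finsupp.single F 1)).congr
        (fun n => ae_of_all _ fun ω => ?_) .rfl
      simp [QuantumGraph.tInj, QuantumGraph.t]
  · exact ⟨_, (hcoe A).trans (A.sum_kInj_eq_variance W).symm, hcoe A,
      fun P _ X G h => h.tendstoInDistribution_tInj A⟩
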